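/- Let $\nu$ be a lattice path, i.e. a finite word in unit north steps $N$ and unit east steps $E$, with $m$ east and $n$ north steps, starting at $(0,0)$. Let $A_\nu$ be the set of lattice points $(x,y)$ with $0\le x\le m$, $0\le y\le n$ that lie weakly above $\nu$, and let $F_\nu$ be the Ferrers diagram of unit cells above $\nu$ in the rectangle $[0,m]\times[0,n]$. *The $\nu$-Tamari lattice.* A $\nu$-path is a lattice path with the same endpoints as $\nu$ that is weakly above $\nu$. For a lattice point $p$ of a $\nu$-path, $\mathrm{horiz}_\nu(p)$ is the maximal number of east steps that can be added to the right of $p$ without crossing $\nu$. For a $\nu$-path $\mu$ and a valley $p$ of $\mu$ (a point preceded by $E$ and followed by $N$), let $q$ be the first lattice point of $\mu$ after $p$ with $\mathrm{horiz}_\nu(q)=\mathrm{horiz}_\nu(p)$, and let $\mu'$ be obtained from $\mu$ by exchanging the step $E$ before $p$ with the subpath of $\mu$ from $p$ to $q$; write $\mu\lessdot_\nu\mu'$. The $\nu$-Tamari lattice $\mathrm{Tam}(\nu)$ is the set of $\nu$-paths ordered by the reflexive transitive closure of $\lessdot_\nu$. *$\nu$-trees.* Two points of $A_\nu$ are $\nu$-incompatible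 if one is strictly southwest of the other and the smallest rectangle containing both lies inside $F_\nu$. A $\nu$-tree is a maximal set of pairwise $\nu$-compatible points of $A_\nu$. *Subword complexes.* Let $s_i=(i\ i{+}1)$. For a word $Q=(q_1,\dots,q_M)$ in simple transpositions of a symmetric group and a permutation $\pi$, the subword complex $SC(Q,\pi)$ is the simplicial complex on $\{1,\dots,M\}$ whose facets are the sets $I$ of positions such that the subword of $Q$ at the positions not in $I$ is a reduced expression of $\pi$. Facets $I,J$ are related by an increasing flip $I\to J$ if $I\setminus\{i\}=J\setminus\{j\}$ with $i\in I$, $j\in J$, $i<j$. The increasing flip poset is the set of facets ordered by the reflexive transitive closure of increasing flips. *The word and the permutation.* For $p=(x,y)\in A_\nu$ put $d(p)=x+n-y$, the lattice distance to the top-left corner $(0,n)$, and let $\hat d=\max_{p\in A_\nu}d(p)$. Label $p$ by $s_{d(p)+1}\in\mathfrak S_{\hat d+2}$, and let $Q_\nu$ be the word obtained by reading the labels of the points of $A_\nu$ row by row from bottom to top, each row from left to right. Let $\pi_\nu\in\mathfrak S_{\hat d+2}$ be the permutation whose Rothe diagram $\{(\pi(j),i): i<j,\ \pi(i)>\pi(j)\}$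 (in matrix coordinates: row, column) equals $F_\nu$ with its northwest cell placed at $(2,2)$. **Theorem.** For every lattice path $\nu$: 1. the permutation $\pi_\nu$ exists and is unique; 2. under the identification of the positions of $Q_\nu$ with the points of $A_\nu$, the facets of $SC(Q_\nu,\pi_\nu)$ are exactly the $\nu$-trees; equivalently, the complements of $\nu$-trees in $A_\nu$ are exactly the subwords of $Q_\nu$ that are reduced expressions of $\pi_\nu$; 3. $\mathrm{Tam}(\nu)$ is isomorphic, as a partially ordered set, to the increasing flip poset of $SC(Q_\nu,\pi_\nu)$; the covering relations of $\mathrm{Tam}(\nu)$ are exactly the relations $\lessdot_\nu$, and those of the flip poset are exactly the increasing flips. -/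

import Mathlib

namespace NuTamari

/-! ### Lattice paths and the region above a path -/

/-- A unit north step or a unit east step. -/
inductive Step
  | N
  | E
  deriving DecidableEq

/-- A lattice path, read as a word in north and east steps; it starts at `(0, 0)`. -/
abbrev LatticePath := List Step

/-- The number of east steps: the width of the smallest rectangle containing the path. -/
def width (ν : LatticePath) : ℕ := ν.count Step.E

/-- The number of north steps: the height of the smallest rectangle containing the path. -/
def height (ν : LatticePath) : ℕ := ν.count Step.N

/-- The end point of a path, as a pair `(x, y)`. -/
def endpoint (ν : LatticePath) : ℕ × ℕ := (width ν, height ν)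

/-- The lattice points on a path: the end points of its initial segments. -/
def points (ν : LatticePath) : List (ℕ × ℕ) := ν.inits.map endpoint

/-- `A ν`: the lattice points of the smallest rectangle containing `ν` that lie on `ν` or
vertically above a lattice point of `ν`. -/
def A (ν : LatticePath) : Finset (ℕ × ℕ) :=
  (Finset.range (width ν + 1) ×ˢ Finset.range (height ν + 1)).filter
    fun p => ∃ v ∈ points ν, v.1 = p.1 ∧ v.2 ≤ p.2

/-- The cells of the Ferrers diagram `F ν` above `ν`, in matrix coordinates: `(r, c)` is the cell
in the `r`-th row from the top and the `c`-th column from the left, both counted from `1`.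
Its lower right corner is the lattice point `(c, height ν - r)`, and the cell lies above `ν`
exactly if this corner does. -/
def ferrers (ν : LatticePath) : Set (ℕ × ℕ) :=
  {rc | 1 ≤ rc.1 ∧ rc.1 ≤ height ν ∧ 1 ≤ rc.2 ∧ rc.2 ≤ width ν ∧ (rc.2, height ν - rc.1) ∈ A ν}

/-! ### The `ν`-Tamari poset -/

/-- A `ν`-path: a path with the same end points as `ν` that lies weakly above `ν`. -/
structure NuPath (ν : LatticePath) where
  word : LatticePath
  endpoint_eq : endpoint word = endpoint ν
  above : ∀ p ∈ points word, p ∈ A ν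

/-- The largest number of east steps that can be made from `p` without crossing `ν`
(for a lattice point `p` weakly above `ν`). -/
def horiz (ν : LatticePath) (p : ℕ × ℕ) : ℕ :=
  Nat.findGreatest (fun h => (p.1 + h, p.2) ∈ A ν) (width ν)

/-- The covering relation of the `ν`-Tamari poset. Here `p = endpoint (a ++ [E])` is a valley of
`μ`, the point `q = endpoint (a ++ E :: N :: d)` is the first lattice point of `μ` after `p` with
`horiz q = horiz p`, and `μ'` arises by exchanging the east step before `p` with the subpath
`N :: d` of `μ` from `p` to `q`. -/
def TamariCover {ν : LatticePath} (μ μ' : NuPath ν) : Prop :=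
  ∃ a d c : LatticePath,
    μ.word = a ++ Step.E :: (Step.N :: d) ++ c ∧
    μ'.word = a ++ (Step.N :: d) ++ Step.E :: c ∧
    horiz ν (endpoint (a ++ Step.E :: Step.N :: d)) = horiz ν (endpoint (a ++ [Step.E])) ∧
    ∀ b : LatticePath, b <+: Step.N :: d → b ≠ [] → b ≠ Step.N :: d →
      horiz ν (endpoint (a ++ Step.E :: b)) ≠ horiz ν (endpoint (a ++ [Step.E]))

/-- Auxiliary weight: the sum over the north steps of the number of east steps before them
(in a path that is preceded by `e` east steps). -/
def eastBeforeNorth : ℕ → LatticePath → ℕ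
  | _, [] => 0
  | e, Step.E :: w => eastBeforeNorth (e + 1) w
  | e, Step.N :: w => e + eastBeforeNorth e w

theorem eastBeforeNorth_append (e : ℕ) (u v : LatticePath) :
    eastBeforeNorth e (u ++ v) = eastBeforeNorth e u + eastBeforeNorth (e + width u) v := by
  induction u generalizing e with
  | nil => simp [eastBeforeNorth, width]
  | cons s u ih =>
    cases s
    · simp [eastBeforeNorth, ih, width, add_assoc]
    · simp [eastBeforeNorth, ih, width, add_comm, add_left_comm]

theorem eastBeforeNorth_mono {e f : ℕ} (h : e ≤ f) (u : LatticePath) :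
    eastBeforeNorth e u ≤ eastBeforeNorth f u := by
  induction u generalizing e f with
  | nil => simp [eastBeforeNorth]
  | cons s u ih =>
    cases s
    · exact add_le_add h (ih h)
    · exact ih (by omega)

theorem TamariCover.weight_lt {ν : LatticePath} {μ μ' : NuPath ν} (h : TamariCover μ μ') :
    eastBeforeNorth 0 μ'.word < eastBeforeNorth 0 μ.word := by
  obtain ⟨a, d, c, h1, h2, -, -⟩ := h
  have h3 := eastBeforeNorth_mono (Nat.le_succ (width a)) d
  have h4 : 0 + width (a ++ Step.N :: d) + 1 = 0 + width (a ++ Step.E :: Step.N :: d) := by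
    simp [width]; omega
  rw [h1, h2, eastBeforeNorth_append 0 (a ++ _) c, eastBeforeNorth_append 0 (a ++ _) (_ :: c),
    eastBeforeNorth_append 0 a, eastBeforeNorth_append 0 a]
  simp only [eastBeforeNorth]
  rw [h4]
  simp only [zero_add] at *
  simp only [Nat.succ_eq_add_one] at h3
  omega

/-- The `ν`-Tamari poset: the reflexive transitive closure of the covering relation. -/
instance (ν : LatticePath) : PartialOrder (NuPath ν) where
  le := Relation.ReflTransGen TamariCover
  le_refl _ := Relation.ReflTransGen.refl
  le_trans _ _ _ := Relation.ReflTransGen.trans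
  le_antisymm μ μ' h h' := by
    have key : ∀ {x y : NuPath ν}, Relation.ReflTransGen TamariCover x y →
        x = y ∨ eastBeforeNorth 0 y.word < eastBeforeNorth 0 x.word := by
      intro x y hxy
      induction hxy with
      | refl => exact Or.inl rfl
      | tail _ hbc ih =>
        refine Or.inr ?_
        rcases ih with rfl | ih
        · exact hbc.weight_lt
        · exact hbc.weight_lt.trans ih
    rcases key h with h1 | h1
    · exact h1
    · rcases key h' with h2 | h2
      · exact h2.symm
      · omega

/-! ### `ν`-trees -/

/-- `p` is strictly southwest of `q` and all of the rectangle spanned by `p` and `q` lies in the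
region weakly above `ν`. -/
def IncompatibleSW (ν : LatticePath) (p q : ℕ × ℕ) : Prop :=
  p.1 < q.1 ∧ p.2 < q.2 ∧
    ∀ r : ℕ × ℕ, p.1 ≤ r.1 → r.1 ≤ q.1 → p.2 ≤ r.2 → r.2 ≤ q.2 → r ∈ A ν

/-- Two lattice points are `ν`-incompatible if one is southwest of the other and the smallest
rectangle containing both lies inside the Ferrers diagram above `ν`. -/
def Incompatible (ν : LatticePath) (p q : ℕ × ℕ) : Prop :=
  IncompatibleSW ν p q ∨ IncompatibleSW ν q p

/-- A `ν`-tree: a maximal set of pairwise `ν`-compatible points of `A ν`. -/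
def IsNuTree (ν : LatticePath) (T : Finset (ℕ × ℕ)) : Prop :=
  Maximal (fun S : Finset (ℕ × ℕ) => S ⊆ A ν ∧ ∀ p ∈ S, ∀ q ∈ S, ¬ Incompatible ν p q) T

/-! ### Subword complexes in the symmetric group -/

/-- The simple transposition exchanging the `i`-th and the next of `n + 1` letters. The letters
are numbered from `0`, so `simple i` is the transposition `s_{i+1} = (i+1 i+2)` of `[n+1]`. -/
def simple {n : ℕ} (i : Fin n) : Equiv.Perm (Fin (n + 1)) :=
  Equiv.swap i.castSucc i.succ

/-- `w` is a reduced expression of `π`: the product of its letters is `π`, and no word in simple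
transpositions with product `π` is shorter. -/
def IsReducedExpression {n : ℕ} (w : List (Fin n)) (π : Equiv.Perm (Fin (n + 1))) : Prop :=
  (w.map simple).prod = π ∧
    ∀ w' : List (Fin n), (w'.map simple).prod = π → w.length ≤ w'.length

/-- The subword of `Q` formed by the letters whose position is not in `I`. -/
def complementSubword {n m : ℕ} (Q : Fin m → Fin n) (I : Finset (Fin m)) : List (Fin n) :=
  ((List.finRange m).filter (fun k => k ∉ I)).map Q

/-- The faces of the subword complex of `Q` and `π`: the sets of positions contained in a set
whose complementary subword is a reduced expression of `π`. -/
def subwordComplex {n m : ℕ} (Q : Fin m → Fin n) (π : Equiv.Perm (Fin (n + 1))) :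
    Set (Finset (Fin m)) :=
  {F | ∃ I, F ⊆ I ∧ IsReducedExpression (complementSubword Q I) π}

/-- The facets: the maximal faces. -/
def IsFacet {n m : ℕ} (Q : Fin m → Fin n) (π : Equiv.Perm (Fin (n + 1)))
    (I : Finset (Fin m)) : Prop :=
  Maximal (fun F => F ∈ subwordComplex Q π) I

/-- The facets are exactly the sets whose complementary subword is a reduced expression. -/
theorem isFacet_iff {n m : ℕ} (Q : Fin m → Fin n) (π : Equiv.Perm (Fin (n + 1)))
    (I : Finset (Fin m)) : IsFacet Q π I ↔ IsReducedExpression (complementSubword Q I) π := by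
  have hlen : ∀ K : Finset (Fin m), (complementSubword Q K).length = Kᶜ.card := by
    intro K
    have hn : ((List.finRange m).filter (fun k => k ∉ K)).Nodup := (List.nodup_finRange m).filter _
    rw [complementSubword, List.length_map, ← List.toFinset_card_of_nodup hn]
    congr 1
    ext k
    simp
  constructor
  · rintro ⟨⟨K, hIK, hK⟩, hmax⟩
    have h : K ≤ I := hmax ⟨K, subset_rfl, hK⟩ hIK
    rwa [Finset.Subset.antisymm hIK h]
  · intro hI
    refine ⟨⟨I, subset_rfl, hI⟩, ?_⟩
    rintro J ⟨K, hJK, hK⟩ hIJ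
    have h1 := hI.2 _ hK.1
    rw [hlen, hlen, Finset.card_compl, Finset.card_compl] at h1
    have h2 := card_finset_fin_le I
    have h3 := card_finset_fin_le K
    have h4 : I = K := Finset.eq_of_subset_of_card_le (Finset.Subset.trans hIJ hJK)
      (by rw [Fintype.card_fin] at h1; omega)
    exact h4 ▸ hJK

/-- The type of facets of the subword complex of `Q` and `π`. -/
structure Facet {n m : ℕ} (Q : Fin m → Fin n) (π : Equiv.Perm (Fin (n + 1))) where
  positions : Finset (Fin m)
  isFacet : IsFacet Q π positions

/-- `J` arises from `I` by an increasing flip: `I \ {i} = J \ {j}` with `i ∈ I`, `j ∈ J`,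
`i < j`. -/
def IncreasingFlip {n m : ℕ} {Q : Fin m → Fin n} {π : Equiv.Perm (Fin (n + 1))}
    (I J : Facet Q π) : Prop :=
  ∃ i ∈ I.positions, ∃ j ∈ J.positions, i < j ∧ I.positions.erase i = J.positions.erase j

theorem IncreasingFlip.sum_lt {n m : ℕ} {Q : Fin m → Fin n} {π : Equiv.Perm (Fin (n + 1))}
    {I J : Facet Q π} (h : IncreasingFlip I J) :
    ∑ k ∈ I.positions, (k : ℕ) < ∑ k ∈ J.positions, (k : ℕ) := by
  obtain ⟨i, hi, j, hj, hij, he⟩ := h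
  rw [← Finset.sum_erase_add _ _ hi, ← Finset.sum_erase_add _ _ hj, he]
  exact Nat.add_lt_add_left hij _

/-- The increasing flip poset: the reflexive transitive closure of increasing flips. -/
instance {n m : ℕ} (Q : Fin m → Fin n) (π : Equiv.Perm (Fin (n + 1))) :
    PartialOrder (Facet Q π) where
  le := Relation.ReflTransGen IncreasingFlip
  le_refl _ := Relation.ReflTransGen.refl
  le_trans _ _ _ := Relation.ReflTransGen.trans
  le_antisymm I J h h' := by
    have key : ∀ {x y : Facet Q π}, Relation.ReflTransGen IncreasingFlip x y →
        x = y ∨ ∑ k ∈ x.positions, (k : ℕ) < ∑ k ∈ y.positions, (k : ℕ) := by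
      intro x y hxy
      induction hxy with
      | refl => exact Or.inl rfl
      | tail _ hbc ih =>
        refine Or.inr ?_
        rcases ih with rfl | ih
        · exact hbc.sum_lt
        · exact ih.trans hbc.sum_lt
    rcases key h with h1 | h1
    · exact h1
    · rcases key h' with h2 | h2
      · exact h2.symm
      · omega

/-! ### The word and the permutation of a lattice path -/

/-- The lattice distance of a point of `A ν` from the top left corner `(0, height ν)`. -/
def dist (ν : LatticePath) (p : ℕ × ℕ) : ℕ := p.1 + (height ν - p.2)

/-- The largest distance of a point of `A ν` from the top left corner. -/
def maxDist (ν : LatticePath) : ℕ := (A ν).sup (dist ν)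

/-- The points of `A ν`, row by row from bottom to top and each row from left to right. -/
def reading (ν : LatticePath) : List (ℕ × ℕ) :=
  (List.range (height ν + 1)).flatMap fun y =>
    ((List.range (width ν + 1)).filter fun x => (x, y) ∈ A ν).map fun x => (x, y)

theorem mem_reading {ν : LatticePath} {p : ℕ × ℕ} : p ∈ reading ν ↔ p ∈ A ν := by
  obtain ⟨x, y⟩ := p
  simp only [reading, List.mem_flatMap, List.mem_map, List.mem_filter, List.mem_range,
    decide_eq_true_eq, Prod.mk.injEq]
  constructor
  · rintro ⟨_, -, _, ⟨-, h⟩, rfl, rfl⟩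
    exact h
  · intro h
    have h' := h
    simp only [A, Finset.mem_filter, Finset.mem_product, Finset.mem_range] at h'
    exact ⟨y, h'.1.2, x, ⟨h'.1.1, h⟩, rfl, rfl⟩

/-- The lattice point at a given position of the reading order. -/
def point (ν : LatticePath) (k : Fin (reading ν).length) : ℕ × ℕ := (reading ν).get k

/-- The word `Q_ν`: the point `p` carries the simple transposition `s_{dist p + 1}`, that is
`simple (dist p)`. -/
def Qword (ν : LatticePath) (k : Fin (reading ν).length) : Fin (maxDist ν + 1) :=
  ⟨dist ν (point ν k),
    Nat.lt_succ_of_le (Finset.le_sup (f := dist ν) (mem_reading.mp (List.get_mem _ k)))⟩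

/-- The Rothe diagram `{(π(j), i) : i < j, π(i) > π(j)}`, with positions and values counted
from `1`. -/
def rothe {n : ℕ} (π : Equiv.Perm (Fin n)) : Set (ℕ × ℕ) :=
  {b | ∃ i j : Fin n, i < j ∧ π j < π i ∧ b = ((π j : ℕ) + 1, (i : ℕ) + 1)}

/-- `π` is the permutation `π_ν`: its Rothe diagram is the Ferrers diagram above `ν`, moved so
that its northwest block lies at `(2, 2)`. -/
def IsNuPerm (ν : LatticePath) (π : Equiv.Perm (Fin (maxDist ν + 1 + 1))) : Prop :=
  rothe π = (fun rc : ℕ × ℕ => (rc.1 + 1, rc.2 + 1)) '' ferrers ν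

end NuTamari

/-!
The three structures are compared through the rows of the rectangle. Write `R y = rowEnd ν y` for
the last abscissa of `A ν` in row `y`.

*Paths.* A `ν`-path is given by its row ends `S y ≤ R y`. In these terms a covering step at row
`y` has as partner the first later row `y'` with `R y' - S y' ≤ R y - S y`, and lowers the row
ends by one in the rows from `y` to before `y'` (`RowCover`, `tamariCover_iff`). Between the two
ends of such a step the rows after `y` can only move away from `ν`, so the step that moves row `y`
must make the whole change at once; hence the steps are the covering relations
(`TamariCover.covBy`).

*Trees.* Call a column dead at height `y` if some lower row contains its point together with a
point to the left. A set is a `ν`-tree exactly if every row is a nonempty terminal segment of its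
live columns and the top row consists of all of them (`isNuTree_iff_flush`). So a `ν`-tree is
determined by the sizes of its rows, and the sizes that occur are one more than the numbers of
east steps in the rows of a `ν`-path. A flip to a higher row removes the leftmost point of a row
and adds a point in the next row that uses the column of the removed point; counting live columns
shows that this is the partner row of the covering relation (`tamariCover_iff_flipAt`).

*Words.* A set of positions of `Q_ν` is read as the set of elbows of a pipe dream; the letters at
the other positions are the crossings. If two rows of two adjacent columns have a crossing at the
upper right and elbows at the other three corners, and both points of every row in between are
crossings, then the crossing at the upper right can be moved to the lower left without changing
the permutation (`Ladder.ev_insert_eq`), because the pipes run vertically in between. A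
reduced pipe dream of `π_ν` or the complement of a `ν`-tree that is not left-justified in all rows
admits such a move, and the moves and their inverses preserve both classes. Each class has only
one left-justified member, the set of lower left corners of the cells above `ν`, so the classes
agree (`isDream_iff`). The product of the letters at these corners has the required Rothe diagram
(`mem_rotheNat_perm_corners`), and the number of cells of the Rothe diagram bounds the length of a
word from below, so that the word is reduced. All products are computed in the permutations of
`ℕ`, where the letters are not bounded.
-/

namespace NuTamari

/-! ### Paths as sequences of row ends -/

/-- The abscissa of the last lattice point of the path `w` at height `y`, that is, the number of
east steps before the north step that leaves height `y`. Above the end of the path it is the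
width of the path. -/
def rowEnd : LatticePath → ℕ → ℕ
  | [], _ => 0
  | Step.E :: w, y => rowEnd w y + 1
  | Step.N :: _, 0 => 0
  | Step.N :: w, y + 1 => rowEnd w y

@[simp] theorem height_nil : height [] = 0 := rfl
@[simp] theorem width_nil : width [] = 0 := rfl
@[simp] theorem height_N (w : LatticePath) : height (Step.N :: w) = height w + 1 := by
  simp [height]
@[simp] theorem height_E (w : LatticePath) : height (Step.E :: w) = height w := by
  simp [height]
@[simp] theorem width_N (w : LatticePath) : width (Step.N :: w) = width w := by
  simp [width]
@[simp] theorem width_E (w : LatticePath) : width (Step.E :: w) = width w + 1 := by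
  simp [width]
@[simp] theorem height_append (u v : LatticePath) : height (u ++ v) = height u + height v := by
  simp [height]
@[simp] theorem width_append (u v : LatticePath) : width (u ++ v) = width u + width v := by
  simp [width]

theorem rowEnd_append_of_lt {u : LatticePath} (v : LatticePath) {y : ℕ} (h : y < height u) :
    rowEnd (u ++ v) y = rowEnd u y := by
  induction u generalizing y with
  | nil => simp at h
  | cons s u ih =>
    cases s
    · cases y with
      | zero => rfl
      | succ y => exact ih (by simpa using h)
    · simp only [List.cons_append, rowEnd]
      rw [ih (by simpa using h)]

theorem rowEnd_append_of_le {u : LatticePath} (v : LatticePath) {y : ℕ} (h : height u ≤ y) :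
    rowEnd (u ++ v) y = width u + rowEnd v (y - height u) := by
  induction u generalizing y with
  | nil => simp
  | cons s u ih =>
    cases s
    · cases y with
      | zero => simp at h
      | succ y =>
        simp only [List.cons_append, rowEnd, width_N, height_N, Nat.add_sub_add_right]
        exact ih (by simpa using h)
    · simp only [List.cons_append, rowEnd, width_E, height_E]
      rw [ih (by simpa using h)]
      omega

theorem rowEnd_of_height_le {w : LatticePath} {y : ℕ} (h : height w ≤ y) :
    rowEnd w y = width w := by
  have := rowEnd_append_of_le [] h
  simpa [rowEnd] using this

theorem rowEnd_mono (w : LatticePath) : Monotone (rowEnd w) := by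
  induction w with
  | nil => exact fun _ _ _ => le_rfl
  | cons s w ih =>
    cases s
    · rintro (_ | y) (_ | z) h
      · exact le_rfl
      · exact Nat.zero_le _
      · omega
      · exact ih (by omega)
    · exact fun y z h => Nat.succ_le_succ (ih h)

theorem rowEnd_le_width (w : LatticePath) (y : ℕ) : rowEnd w y ≤ width w := by
  rw [← rowEnd_of_height_le (le_max_left (height w) y)]
  exact rowEnd_mono w (le_max_right _ _)

theorem mem_points {w : LatticePath} {p : ℕ × ℕ} :
    p ∈ points w ↔ ∃ u v, w = u ++ v ∧ endpoint u = p := by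
  simp only [points, List.mem_map, List.mem_inits]
  constructor
  · rintro ⟨u, ⟨v, rfl⟩, h⟩
    exact ⟨u, v, rfl, h⟩
  · rintro ⟨u, v, rfl, h⟩
    exact ⟨u, ⟨v, rfl⟩, h⟩

theorem exists_prefix_of_le_rowEnd {w : LatticePath} {x y : ℕ} (h : x ≤ rowEnd w y) :
    ∃ u v, w = u ++ v ∧ width u = x ∧ height u ≤ y := by
  induction w generalizing x y with
  | nil => exact ⟨[], [], rfl, (Nat.le_zero.1 h).symm, by simp⟩
  | cons s w ih =>
    cases x with
    | zero => exact ⟨[], _, rfl, rfl, by simp⟩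
    | succ x =>
      cases s
      · cases y with
        | zero => simp [rowEnd] at h
        | succ y =>
          obtain ⟨u, v, rfl, h1, h2⟩ := ih h
          exact ⟨Step.N :: u, v, rfl, by simpa using h1, by simpa using h2⟩
      · obtain ⟨u, v, rfl, h1, h2⟩ := ih (x := x) (y := y) (by simpa [rowEnd] using h)
        exact ⟨Step.E :: u, v, rfl, by simpa using h1, by simpa using h2⟩

/-- The points of `A ν` in row `y` are those with `x ≤ rowEnd ν y`. -/
theorem mem_A {ν : LatticePath} {x y : ℕ} :
    (x, y) ∈ A ν ↔ y ≤ height ν ∧ x ≤ rowEnd ν y := by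
  simp only [A, Finset.mem_filter, Finset.mem_product, Finset.mem_range, mem_points]
  constructor
  · rintro ⟨⟨-, h1⟩, v, ⟨a, b, rfl, rfl⟩, h2, h3⟩
    refine ⟨by omega, ?_⟩
    simp only [endpoint] at h2 h3
    rw [rowEnd_append_of_le _ h3]
    omega
  · rintro ⟨h1, h2⟩
    obtain ⟨u, v, h3, h4, h5⟩ := exists_prefix_of_le_rowEnd h2
    have := rowEnd_le_width ν y
    exact ⟨⟨by omega, by omega⟩, endpoint u, ⟨u, v, h3, rfl⟩, h4, h5⟩

/-- A point of a path splits the path. -/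
theorem exists_split_of_rowEnd {w : LatticePath} {x y : ℕ} (hy : y ≤ height w)
    (h : x ≤ rowEnd w y) (h' : ∀ z < y, rowEnd w z ≤ x) :
    ∃ u v, w = u ++ v ∧ width u = x ∧ height u = y := by
  induction w generalizing x y with
  | nil => exact ⟨[], [], rfl, (Nat.le_zero.1 h).symm, (Nat.le_zero.1 hy).symm⟩
  | cons s w ih =>
    cases s
    · cases y with
      | zero =>
        have : x = 0 := by simpa [rowEnd] using h
        exact ⟨[], _, rfl, this.symm, rfl⟩
      | succ y =>
        obtain ⟨u, v, rfl, h1, h2⟩ := ih (by simpa using hy) h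
          (fun z hz => h' (z + 1) (by omega))
        exact ⟨Step.N :: u, v, rfl, by simpa using h1, by simpa using h2⟩
    · cases x with
      | zero =>
        have : y = 0 := by
          by_contra hy0
          have := h' 0 (by omega)
          simp [rowEnd] at this
        exact ⟨[], _, rfl, rfl, this.symm⟩
      | succ x =>
        obtain ⟨u, v, rfl, h1, h2⟩ := ih (x := x) (y := y) (by simpa using hy)
          (by simpa [rowEnd] using h) (fun z hz => by simpa [rowEnd] using h' z hz)
        exact ⟨Step.E :: u, v, rfl, by simpa using h1, by simpa using h2⟩

theorem eq_of_rowEnd_eq {w w' : LatticePath} (hh : height w = height w')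
    (h : ∀ y ≤ height w, rowEnd w y = rowEnd w' y) : w = w' := by
  induction w generalizing w' with
  | nil =>
    cases w' with
    | nil => rfl
    | cons s w' =>
      cases s
      · simp at hh
      · simpa [rowEnd] using h 0 le_rfl
  | cons s w ih =>
    cases w' with
    | nil =>
      cases s
      · simp at hh
      · simpa [rowEnd] using h 0 (Nat.zero_le _)
    | cons s' w' =>
      cases s <;> cases s'
      · rw [ih (by simpa using hh) fun y hy => h (y + 1) (by simpa using hy)]
      · simpa [rowEnd] using h 0 (Nat.zero_le _)
      · simpa [rowEnd] using h 0 (Nat.zero_le _)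
      · rw [ih (by simpa using hh) fun y hy => by simpa [rowEnd] using h y (by simpa using hy)]

theorem height_replicate_E (k : ℕ) : height (List.replicate k Step.E) = 0 := by
  simp [height, List.count_replicate]

theorem width_replicate_E (k : ℕ) : width (List.replicate k Step.E) = k := by
  simp [width]

theorem exists_path_of_rowEnd (n : ℕ) (S : ℕ → ℕ) (hS : ∀ y < n, S y ≤ S (y + 1)) :
    ∃ w : LatticePath, height w = n ∧ ∀ y ≤ n, rowEnd w y = S y := by
  induction n with
  | zero =>
    refine ⟨List.replicate (S 0) Step.E, height_replicate_E _, ?_⟩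
    rintro y hy
    obtain rfl : y = 0 := by omega
    rw [rowEnd_of_height_le (height_replicate_E _).le, width_replicate_E]
  | succ n ih =>
    obtain ⟨u, h1, h2⟩ := ih fun y hy => hS y (by omega)
    have h3 : width u = S n := by rw [← rowEnd_of_height_le h1.le, h2 n le_rfl]
    have h4 := hS n (by omega)
    refine ⟨u ++ Step.N :: List.replicate (S (n + 1) - S n) Step.E, ?_, fun y hy => ?_⟩
    · simp [h1, height_replicate_E]
    · rcases Nat.lt_or_ge y n with hyn | hyn
      · rw [rowEnd_append_of_lt _ (by omega), h2 y hyn.le]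
      · rw [rowEnd_append_of_le _ (by omega), h3, h1]
        obtain rfl | rfl : y = n ∨ y = n + 1 := by omega
        · simp [rowEnd]
        · simp only [Nat.add_sub_cancel_left, rowEnd]
          rw [rowEnd_of_height_le (height_replicate_E _).le, width_replicate_E]
          omega

/-! ### The covering relation in terms of row ends -/

theorem horiz_eq {ν : LatticePath} {x y : ℕ} (h : (x, y) ∈ A ν) :
    horiz ν (x, y) = rowEnd ν y - x := by
  rw [mem_A] at h
  have := rowEnd_le_width ν y
  rw [horiz, Nat.findGreatest_eq_iff]
  refine ⟨by omega, fun _ => mem_A.2 ⟨h.1, by simp; omega⟩, fun k hk _ hk' => ?_⟩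
  have := (mem_A.1 hk').2
  simp only at this
  omega

namespace NuPath

variable {ν : LatticePath} (μ : NuPath ν)

theorem height_word : height μ.word = height ν := congrArg Prod.snd μ.endpoint_eq

theorem width_word : width μ.word = width ν := congrArg Prod.fst μ.endpoint_eq

theorem rowEnd_le {y : ℕ} (hy : y ≤ height ν) : rowEnd μ.word y ≤ rowEnd ν y := by
  obtain ⟨u, v, h1, h2, h3⟩ := exists_split_of_rowEnd (w := μ.word) (x := rowEnd μ.word y) (y := y)
    (μ.height_word ▸ hy) le_rfl (fun z hz => rowEnd_mono _ hz.le)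
  have := μ.above (rowEnd μ.word y, y) (mem_points.2 ⟨u, v, h1, by rw [endpoint, h2, h3]⟩)
  exact (mem_A.1 this).2

theorem rowEnd_top : rowEnd μ.word (height ν) = width ν := by
  rw [rowEnd_of_height_le μ.height_word.le, μ.width_word]

theorem ext_word {μ μ' : NuPath ν} (h : μ.word = μ'.word) : μ = μ' := by
  cases μ; cases μ'; cases h; rfl

theorem ext_rowEnd {μ μ' : NuPath ν}
    (h : ∀ y ≤ height ν, rowEnd μ.word y = rowEnd μ'.word y) : μ = μ' :=
  ext_word (eq_of_rowEnd_eq (by rw [μ.height_word, μ'.height_word])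
    fun y hy => h y (by rwa [μ.height_word] at hy))

theorem mem_A_of_split {u v : LatticePath} (h : μ.word = u ++ v) : endpoint u ∈ A ν :=
  μ.above _ (mem_points.2 ⟨u, v, h, rfl⟩)

end NuPath

theorem exists_nuPath (ν : LatticePath) (S : ℕ → ℕ) (hS : ∀ y < height ν, S y ≤ S (y + 1))
    (hR : ∀ y ≤ height ν, S y ≤ rowEnd ν y) (hn : S (height ν) = width ν) :
    ∃ μ : NuPath ν, ∀ y ≤ height ν, rowEnd μ.word y = S y := by
  obtain ⟨w, h1, h2⟩ := exists_path_of_rowEnd (height ν) S hS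
  have hw : width w = width ν := by rw [← hn, ← h2 _ le_rfl, rowEnd_of_height_le h1.le]
  refine ⟨⟨w, by rw [endpoint, endpoint, h1, hw], ?_⟩, h2⟩
  intro p hp
  obtain ⟨u, v, rfl, rfl⟩ := mem_points.1 hp
  have hu : height u ≤ height ν := by rw [← h1]; simp
  refine mem_A.2 ⟨hu, le_trans ?_ (hR _ hu)⟩
  rw [← h2 _ hu, rowEnd_append_of_le _ le_rfl]
  omega

theorem exists_split_north {w : LatticePath} {y : ℕ} (hy : y < height w) :
    ∃ u v, w = u ++ Step.N :: v ∧ height u = y ∧ width u = rowEnd w y := by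
  induction w generalizing y with
  | nil => simp at hy
  | cons s w ih =>
    cases s
    · cases y with
      | zero => exact ⟨[], w, rfl, rfl, rfl⟩
      | succ y =>
        obtain ⟨u, v, h, h1, h2⟩ := ih (y := y) (by simpa using hy)
        exact ⟨Step.N :: u, v, by rw [h]; rfl, by simpa using h1, by simpa [rowEnd] using h2⟩
    · obtain ⟨u, v, h, h1, h2⟩ := ih (y := y) (by simpa using hy)
      exact ⟨Step.E :: u, v, by rw [h]; rfl, by simpa using h1, by simpa [rowEnd] using h2⟩

/-- Moving an east step behind the subpath `b` lowers the row ends by one in the rows that `b`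
leaves by a north step. -/
theorem rowEnd_move_east (a b c : LatticePath) (z : ℕ) :
    rowEnd (a ++ Step.E :: b ++ c) z = rowEnd (a ++ b ++ Step.E :: c) z +
      if height a ≤ z ∧ z < height a + height b then 1 else 0 := by
  rw [List.append_assoc, List.append_assoc, List.cons_append]
  rcases Nat.lt_or_ge z (height a) with h | h
  · rw [rowEnd_append_of_lt _ h, rowEnd_append_of_lt _ h, if_neg (by omega), add_zero]
  · rw [rowEnd_append_of_le _ h, rowEnd_append_of_le _ h, rowEnd]
    rcases Nat.lt_or_ge (z - height a) (height b) with h' | h'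
    · rw [rowEnd_append_of_lt _ h', rowEnd_append_of_lt _ h', if_pos (by omega)]
      omega
    · rw [rowEnd_append_of_le _ h', rowEnd_append_of_le _ h', rowEnd, if_neg (by omega)]
      omega

/-- `S` and `S'` are the row ends of two paths, `R` those of `ν`: the second path arises from the
first one by the covering relation at a valley in row `y` whose partner lies in row `y'`. The
numbers `R z - S z` are the distances of the path from `ν` at the end of row `z`; row `y'` is the
first row after `y` whose distance is at most that of row `y`, and the distance grows by one in
the rows from `y` to before `y'`. -/
def RowCover (n : ℕ) (R S S' : ℕ → ℕ) (y y' : ℕ) : Prop :=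
  y < y' ∧ y' ≤ n ∧ R y' + S y ≤ R y + S y' ∧
    (∀ z, y < z → z < y' → R y + S z < R z + S y) ∧
    ∀ z ≤ n, S z = S' z + if y ≤ z ∧ z < y' then 1 else 0

theorem TamariCover.exists_rowCover {ν : LatticePath} {μ μ' : NuPath ν} (h : TamariCover μ μ') :
    ∃ y y', RowCover (height ν) (rowEnd ν) (rowEnd μ.word) (rowEnd μ'.word) y y' := by
  obtain ⟨a, d, c, h1, h2, h3, h4⟩ := h
  have hA : ∀ b : LatticePath, b <+: Step.N :: d → endpoint (a ++ Step.E :: b) ∈ A ν := by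
    rintro b ⟨e, he⟩
    refine μ.mem_A_of_split (v := e ++ c) ?_
    rw [h1, ← he]
    simp
  have hh : height a + 1 + height d ≤ height ν := by
    rw [← μ.height_word, h1]
    simp
    omega
  have hz : ∀ b : LatticePath, b <+: Step.N :: d →
      horiz ν (endpoint (a ++ Step.E :: b)) =
        rowEnd ν (height a + height b) - (width a + 1 + width b) ∧
      width a + 1 + width b ≤ rowEnd ν (height a + height b) := by
    intro b hb
    have e : endpoint (a ++ Step.E :: b) = (width a + 1 + width b, height a + height b) := by
      simp [endpoint]
      omega
    have := hA b hb
    rw [e] at this ⊢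
    exact ⟨horiz_eq this, (mem_A.1 this).2⟩
  have h0 := hz [] (List.nil_prefix)
  have hd := hz _ (List.prefix_refl _)
  rw [show a ++ Step.E :: Step.N :: d = a ++ Step.E :: (Step.N :: d) from rfl] at h3
  simp only [width_nil, height_nil, width_N, height_N, add_zero] at h0 hd
  have hgt : ∀ b : LatticePath, b <+: Step.N :: d → b ≠ [] → b ≠ Step.N :: d →
      rowEnd ν (height a) + width b < rowEnd ν (height a + height b) := by
    intro b
    induction b using List.reverseRecOn with
    | nil => exact fun _ h => absurd rfl h
    | append_singleton b s ih =>
      intro hb _ hne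
      have e1 := h4 _ hb (by simp) hne
      have e2 := hz _ hb
      have hb' : b <+: Step.N :: d := (List.prefix_append b [s]).trans hb
      rcases eq_or_ne b [] with rfl | hb0
      · obtain rfl : s = Step.N := by simpa using hb
        have := rowEnd_mono ν (Nat.le_add_right (height a) 1)
        simp only [List.nil_append, width_N, height_N, height_nil, width_nil, zero_add,
          add_zero] at e2 ⊢
        rw [List.nil_append] at e1
        omega
      · have hb1 : b ≠ Step.N :: d := by
          rintro rfl
          have := hb.length_le
          simp at this
        have e3 := ih hb' hb0 hb1
        have := rowEnd_mono ν (Nat.le_add_right (height a + height b) 1)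
        cases s
        · simp [← add_assoc] at e2 ⊢
          omega
        · simp [← add_assoc] at e2 ⊢
          omega
  have hS : ∀ z, rowEnd μ.word z = rowEnd μ'.word z +
      if height a ≤ z ∧ z < height a + (height d + 1) then 1 else 0 := by
    intro z
    rw [h1, h2, rowEnd_move_east a (Step.N :: d) c z, height_N]
  have e0 : rowEnd μ.word (height a) = width a + 1 := by
    rw [h1, List.append_assoc, rowEnd_append_of_le _ le_rfl]
    simp [rowEnd]
  refine ⟨height a, height a + (height d + 1), by omega, by omega, ?_, ?_, fun z _ => hS z⟩
  · have : width a + 1 + width d ≤ rowEnd μ.word (height a + (height d + 1)) := by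
      rw [h1, rowEnd_append_of_le _ (by simp)]
      simp
      omega
    omega
  · intro z hz1 hz2
    obtain ⟨u, v, rfl, hu, hu'⟩ := exists_split_north (w := d) (y := z - height a - 1) (by omega)
    have e1 := hgt (Step.N :: u) ⟨Step.N :: v, by simp⟩ (by simp) (by simp)
    have e2 : rowEnd μ.word z = width a + 1 + width u := by
      rw [h1, List.append_assoc, rowEnd_append_of_le _ (by omega), List.cons_append, rowEnd,
        show z - height a = (z - height a - 1) + 1 by omega, List.cons_append, rowEnd,
        rowEnd_append_of_lt _ (by simp; omega), ← hu']
      omega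
    rw [e2, e0]
    simp only [width_N, height_N] at e1
    rw [show height a + (height u + 1) = z by omega] at e1
    omega

theorem RowCover.tamariCover {ν : LatticePath} {μ μ' : NuPath ν} {y y' : ℕ}
    (h : RowCover (height ν) (rowEnd ν) (rowEnd μ.word) (rowEnd μ'.word) y y') :
    TamariCover μ μ' := by
  obtain ⟨h1, h2, h3, h4, h5⟩ := h
  set S := rowEnd μ.word with hS
  set S' := rowEnd μ'.word with hS'
  have hSR : ∀ z ≤ height ν, S z ≤ rowEnd ν z := fun z hz => μ.rowEnd_le hz
  obtain ⟨u, v, huv, hu1, hu2⟩ := exists_split_north (w := μ.word) (y := y)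
    (by rw [μ.height_word]; omega)
  rw [← hS] at hu2
  have h5y := h5 y (by omega)
  rw [if_pos ⟨le_rfl, h1⟩] at h5y
  obtain ⟨a, rfl⟩ : ∃ a, u = a ++ [Step.E] := by
    rcases List.eq_nil_or_concat u with rfl | ⟨a, s, rfl⟩
    · simp at hu2
      omega
    · cases s
      · exfalso
        simp at hu1 hu2
        have e1 : S (y - 1) = S y := by
          rw [← hu2, hS, huv, List.concat_eq_append, List.append_assoc,
            rowEnd_append_of_le _ (by omega), show y - 1 - height a = 0 by omega]
          rfl
        have e2 := h5 (y - 1) (by omega)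
        rw [if_neg (by omega)] at e2
        have e3 : S' (y - 1) ≤ S' y := rowEnd_mono _ (by omega)
        omega
      · exact ⟨a, by simp⟩
  simp at hu1 hu2
  -- the partner of the valley is the point of row `y'` with the same distance to `ν`
  obtain ⟨x, hx⟩ : ∃ x, rowEnd ν y' + S y = rowEnd ν y + x :=
    ⟨rowEnd ν y' + S y - rowEnd ν y, by have := rowEnd_mono ν h1.le; omega⟩
  have hlt : ∀ z < y', S z ≤ x := by
    intro z hz
    have e1 : S z ≤ S (y' - 1) := rowEnd_mono _ (by omega)
    have e2 := rowEnd_mono ν (show y' - 1 ≤ y' by omega)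
    rcases Nat.lt_or_ge y (y' - 1) with hy | hy
    · have := h4 (y' - 1) hy (by omega)
      omega
    · obtain rfl : y = y' - 1 := by omega
      omega
  obtain ⟨w, c, hw, hw1, hw2⟩ := exists_split_of_rowEnd (w := μ.word) (x := x) (y := y')
    (by rw [μ.height_word]; omega) (by rw [← hS]; omega) hlt
  have hlen : a ++ [Step.E, Step.N] <+: w := by
    have p1 : a ++ [Step.E, Step.N] <+: μ.word := ⟨v, by rw [huv]; simp⟩
    have p2 : w <+: μ.word := ⟨c, hw.symm⟩
    rcases List.prefix_or_prefix_of_prefix p1 p2 with h | h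
    · exact h
    · rw [show a ++ [Step.E, Step.N] = (a ++ [Step.E]) ++ [Step.N] by simp,
        List.prefix_concat_iff] at h
      rcases h with h | h
      · rw [h]
        simp
      · have : height w ≤ height (a ++ [Step.E]) := h.sublist.count_le Step.N
        simp only [height_append, height_E, height_nil, add_zero] at this
        omega
  obtain ⟨d, rfl⟩ := hlen
  simp at hw1 hw2
  have hA : ∀ b : LatticePath, b <+: Step.N :: d →
      (width a + 1 + width b, height a + height b) ∈ A ν := by
    rintro b ⟨e, he⟩
    have : endpoint (a ++ Step.E :: b) ∈ A ν := by
      refine μ.mem_A_of_split (v := e ++ c) ?_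
      rw [hw]
      simp only [List.append_assoc, List.cons_append, List.nil_append, List.append_cancel_left_eq,
        List.cons.injEq, true_and]
      rw [← List.append_assoc, he]
      rfl
    have e : endpoint (a ++ Step.E :: b) = (width a + 1 + width b, height a + height b) := by
      simp [endpoint]
      omega
    rwa [e] at this
  have hz : ∀ b : LatticePath, b <+: Step.N :: d →
      horiz ν (endpoint (a ++ Step.E :: b)) =
        rowEnd ν (height a + height b) - (width a + 1 + width b) := by
    intro b hb
    have e : endpoint (a ++ Step.E :: b) = (width a + 1 + width b, height a + height b) := by
      simp [endpoint]
      omega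
    rw [e, horiz_eq (hA b hb)]
  have hSy := hSR y (by omega)
  refine ⟨a, d, c, by rw [hw]; simp, ?_, ?_, ?_⟩
  · refine eq_of_rowEnd_eq ?_ ?_
    · rw [μ'.height_word, ← μ.height_word, hw]
      simp
    · intro z hzn
      rw [μ'.height_word] at hzn
      have e1 := h5 z hzn
      have e2 := rowEnd_move_east a (Step.N :: d) c z
      rw [show a ++ Step.E :: Step.N :: d ++ c = μ.word by rw [hw]; simp, ← hS, height_N,
        hu1, show y + (height d + 1) = y' by omega] at e2
      rw [← hS']
      omega
  · rw [show a ++ Step.E :: Step.N :: d = a ++ Step.E :: (Step.N :: d) from rfl,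
      hz _ (List.prefix_refl _), hz [] List.nil_prefix]
    simp only [width_N, height_N, width_nil, height_nil, add_zero]
    rw [hu1, show y + (height d + 1) = y' by omega]
    omega
  · intro b hb hb0 hbne
    rw [hz b hb, hz [] List.nil_prefix]
    obtain ⟨e, he⟩ := hb
    have hb1 : 1 ≤ height b := by
      cases b with
      | nil => exact absurd rfl hb0
      | cons s b =>
        obtain rfl : s = Step.N := by simpa using (List.cons_eq_cons.1 he).1
        simp
    have e0 := (mem_A.1 (hA b ⟨e, he⟩)).2
    have e1 : height b + height e = height d + 1 := by
      rw [← height_append, he, height_N]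
    have e2 : width b + width e = width d := by
      rw [← width_append, he, width_N]
    simp only [width_nil, height_nil, add_zero]
    rw [hu1] at e0 ⊢
    rcases Nat.eq_zero_or_pos (height e) with he0 | he0
    · have he1 : 0 < width e := by
        cases e with
        | nil => simp at he; exact absurd he hbne
        | cons s e => cases s <;> simp at he0 ⊢
      rw [show y + height b = y' by omega] at e0 ⊢
      omega
    · have e3 := h4 (y + height b) (by omega) (by omega)
      have e4 : width a + 1 + width b ≤ S (y + height b) := by
        rw [hS, hw, show a ++ [Step.E, Step.N] ++ d ++ c = (a ++ Step.E :: b) ++ (e ++ c) by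
          have : d ++ c = (d ++ c) := rfl
          have he' : b ++ (e ++ c) = Step.N :: (d ++ c) := by rw [← List.append_assoc, he]; rfl
          simp [he'], rowEnd_append_of_le _ (by simp; omega)]
        simp
        omega
      omega

theorem tamariCover_iff {ν : LatticePath} {μ μ' : NuPath ν} :
    TamariCover μ μ' ↔
      ∃ y y', RowCover (height ν) (rowEnd ν) (rowEnd μ.word) (rowEnd μ'.word) y y' :=
  ⟨fun h => h.exists_rowCover, fun ⟨_, _, h⟩ => h.tamariCover⟩

theorem NuPath.rowEnd_antitone {ν : LatticePath} {μ μ' : NuPath ν} (h : μ ≤ μ') {z : ℕ}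
    (hz : z ≤ height ν) : rowEnd μ'.word z ≤ rowEnd μ.word z := by
  change Relation.ReflTransGen TamariCover μ μ' at h
  induction h with
  | refl => exact le_rfl
  | tail _ hc ih =>
    obtain ⟨y, y', hc⟩ := hc.exists_rowCover
    have := hc.2.2.2.2 z hz
    omega

theorem TamariCover.lt {ν : LatticePath} {μ μ' : NuPath ν} (h : TamariCover μ μ') : μ < μ' := by
  refine lt_of_le_of_ne (Relation.ReflTransGen.single h) ?_
  rintro rfl
  exact absurd h.weight_lt (lt_irrefl _)

/-- If `μ'` arises from `μ` by the covering relation at row `y`, and a step between `μ` and `μ'`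
moves the end of row `y`, then it is the whole step from `μ` to `μ'`: before it the distances to `ν`
can only have grown in the rows after `y`, so that the partner row of `y` is not before `y'`. -/
theorem RowCover.eq_of_step {ν : LatticePath} {μ μ' κ κ' : NuPath ν} {y y' : ℕ}
    (h : RowCover (height ν) (rowEnd ν) (rowEnd μ.word) (rowEnd μ'.word) y y')
    (h1 : μ ≤ κ) (h2 : TamariCover κ κ') (h3 : κ' ≤ μ')
    (hy : rowEnd κ.word y = rowEnd μ.word y) (hy' : rowEnd κ'.word y ≠ rowEnd μ.word y) :
    κ = μ ∧ κ' = μ' := by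
  obtain ⟨a, b, c1, c2, c3, c4, c5⟩ := h2.exists_rowCover
  obtain ⟨d1, d2, d3, d4, d5⟩ := h
  have l1 : ∀ z ≤ height ν, rowEnd κ.word z ≤ rowEnd μ.word z :=
    fun z hz => NuPath.rowEnd_antitone h1 hz
  have l3 : ∀ z ≤ height ν, rowEnd μ'.word z ≤ rowEnd κ'.word z :=
    fun z hz => NuPath.rowEnd_antitone h3 hz
  have hyn : y ≤ height ν := by omega
  have ha : a ≤ y ∧ y < b := by
    by_contra hcon
    have := c5 y hyn
    rw [if_neg hcon] at this
    omega
  obtain rfl : a = y := by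
    by_contra hne
    have e1 := c5 a (by omega)
    have e2 := d5 a (by omega)
    rw [if_pos ⟨le_rfl, c1⟩] at e1
    rw [if_neg (by omega)] at e2
    have := l1 a (by omega)
    have := l3 a (by omega)
    omega
  obtain rfl : b = y' := by
    rcases lt_trichotomy b y' with hb | hb | hb
    · have := d4 b c1 hb
      have := l1 b c2
      omega
    · exact hb
    · have e1 := c5 y' d2
      have e2 := d5 y' d2
      rw [if_pos ⟨d1.le, hb⟩] at e1
      rw [if_neg (by omega)] at e2
      have := l1 y' d2
      have := l3 y' d2
      omega
  constructor <;>
  · refine NuPath.ext_rowEnd fun z hz => ?_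
    have := l1 z hz
    have := l3 z hz
    have := c5 z hz
    have := d5 z hz
    omega

theorem TamariCover.covBy {ν : LatticePath} {μ μ' : NuPath ν} (h : TamariCover μ μ') :
    μ ⋖ μ' := by
  refine ⟨h.lt, fun κ h1 h2 => ?_⟩
  obtain ⟨y, y', hc⟩ := h.exists_rowCover
  have up : ∀ κ : NuPath ν, Relation.ReflTransGen TamariCover μ κ → κ ≤ μ' →
      κ = μ' ∨ rowEnd κ.word y = rowEnd μ.word y := by
    intro κ hκ
    induction hκ with
    | refl => exact fun _ => Or.inr rfl
    | @tail ρ κ hρ hcov ih =>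
      intro hle
      rcases ih (hcov.lt.le.trans hle) with rfl | hy
      · exact absurd (hcov.lt.trans_le hle) (lt_irrefl _)
      · by_cases hy' : rowEnd κ.word y = rowEnd μ.word y
        · exact Or.inr hy'
        · exact Or.inl (hc.eq_of_step hρ hcov hle hy hy').2
  have down : ∀ κ : NuPath ν, Relation.ReflTransGen TamariCover κ μ' → μ ≤ κ → κ ≠ μ' →
      rowEnd κ.word y = rowEnd μ.word y → κ = μ := by
    intro κ hκ
    induction hκ using Relation.ReflTransGen.head_induction_on with
    | refl => exact fun _ hne _ => absurd rfl hne
    | @head κ ρ hcov hρ ih =>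
      intro hle _ hy
      by_cases hy' : rowEnd ρ.word y = rowEnd μ.word y
      · have hne : ρ ≠ μ' := by
          rintro rfl
          have := hc.2.2.2.2 y (by have := hc.1; have := hc.2.1; omega)
          rw [if_pos ⟨le_rfl, hc.1⟩] at this
          omega
        have := ih (hle.trans hcov.lt.le) hne hy'
        exact absurd (this ▸ hcov.lt) (not_lt_of_ge hle)
      · exact (hc.eq_of_step hle hcov hρ hy hy').1
  rcases up κ h1.le h2.le with hκ | hκ
  · exact h2.ne hκ
  · exact h1.ne' (down κ h2.le h1.le h2.ne hκ)

theorem covBy_iff_tamariCover {ν : LatticePath} {μ μ' : NuPath ν} :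
    μ ⋖ μ' ↔ TamariCover μ μ' := by
  refine ⟨fun h => ?_, TamariCover.covBy⟩
  have h1 : Relation.ReflTransGen TamariCover μ μ' := h.le
  rcases Relation.ReflTransGen.cases_head h1 with h2 | ⟨κ, h2, h3⟩
  · exact absurd h2 h.ne
  · have h4 : κ ≤ μ' := h3
    rcases h4.eq_or_lt with rfl | h4
    · exact h2
    · exact absurd h4 (h.2 h2.lt)

/-! ### `ν`-trees row by row -/

/-- For points of `A ν`: the point `p` is strictly southwest of `q`, and the lower right corner of
the rectangle that they span lies weakly above `ν`. -/
def SW (ν : LatticePath) (p q : ℕ × ℕ) : Prop :=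
  p.1 < q.1 ∧ p.2 < q.2 ∧ q.1 ≤ rowEnd ν p.2

theorem incompatibleSW_iff {ν : LatticePath} {p q : ℕ × ℕ} (hq : q ∈ A ν) :
    IncompatibleSW ν p q ↔ SW ν p q := by
  have hq' := mem_A.1 (show (q.1, q.2) ∈ A ν from hq)
  constructor
  · rintro ⟨h1, h2, h3⟩
    exact ⟨h1, h2, (mem_A.1 (h3 (q.1, p.2) h1.le le_rfl le_rfl h2.le)).2⟩
  · rintro ⟨h1, h2, h3⟩
    refine ⟨h1, h2, fun r _ h5 h6 h7 => mem_A.2 ⟨by omega, ?_⟩⟩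
    exact h5.trans (h3.trans (rowEnd_mono ν h6))

theorem isNuTree_iff {ν : LatticePath} {T : Finset (ℕ × ℕ)} :
    IsNuTree ν T ↔ T ⊆ A ν ∧ (∀ p ∈ T, ∀ q ∈ T, ¬ SW ν p q) ∧
      ∀ r ∈ A ν, r ∉ T → ∃ t ∈ T, SW ν r t ∨ SW ν t r := by
  constructor
  · rintro ⟨⟨h1, h2⟩, h3⟩
    refine ⟨h1, fun p hp q hq h => h2 p hp q hq (Or.inl ((incompatibleSW_iff (h1 hq)).2 h)), ?_⟩
    intro r hr hrT
    by_contra! hcon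
    refine hrT (h3 (y := insert r T) ⟨?_, ?_⟩ (Finset.subset_insert r T)
      (Finset.mem_insert_self r T))
    · exact Finset.insert_subset hr h1
    · have hrr : ¬ Incompatible ν r r := by
        rintro (h | h) <;> exact lt_irrefl _ h.1
      have hrt : ∀ t ∈ T, ¬ Incompatible ν r t ∧ ¬ Incompatible ν t r := by
        intro t ht
        have := hcon t ht
        simp only [Incompatible, incompatibleSW_iff hr, incompatibleSW_iff (h1 ht)]
        tauto
      intro p hp q hq
      rcases Finset.mem_insert.1 hp with rfl | hp' <;>
        rcases Finset.mem_insert.1 hq with rfl | hq'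
      · exact hrr
      · exact (hrt q hq').1
      · exact (hrt p hp').2
      · exact h2 p hp' q hq'
  · rintro ⟨h1, h2, h3⟩
    refine ⟨⟨h1, ?_⟩, ?_⟩
    · rintro p hp q hq (h | h)
      · exact h2 p hp q hq ((incompatibleSW_iff (h1 hq)).1 h)
      · exact h2 q hq p hp ((incompatibleSW_iff (h1 hp)).1 h)
    · rintro S ⟨hS, hS'⟩ hTS r hr
      by_contra hrT
      obtain ⟨t, ht, h | h⟩ := h3 r (hS hr) hrT
      · exact hS' r hr t (hTS ht) (Or.inl ((incompatibleSW_iff (h1 ht)).2 h))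
      · exact hS' t (hTS ht) r hr (Or.inl ((incompatibleSW_iff (hS hr)).2 h))

/-- The column `x` is live at height `y`: in no row below `y` does `T` contain the point of the
column together with a point to its left. Only points in live columns are compatible with
the rows of `T` below `y`. -/
def Live (T : Finset (ℕ × ℕ)) (x y : ℕ) : Prop :=
  ∀ b < y, (x, b) ∈ T → ∀ a < x, (a, b) ∉ T

theorem Live.anti {T : Finset (ℕ × ℕ)} {x y z : ℕ} (h : Live T x y) (hz : z ≤ y) : Live T x z :=
  fun b hb => h b (by omega)

theorem live_zero (T : Finset (ℕ × ℕ)) (y : ℕ) : Live T 0 y :=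
  fun _ _ _ _ ha => absurd ha (Nat.not_lt_zero _)

theorem live_congr {T T' : Finset (ℕ × ℕ)} {y : ℕ}
    (h : ∀ x, ∀ b < y, (x, b) ∈ T ↔ (x, b) ∈ T') (x : ℕ) : Live T x y ↔ Live T' x y := by
  constructor
  · intro hl b hb hx a ha ha'
    exact hl b hb ((h x b hb).2 hx) a ha ((h a b hb).2 ha')
  · intro hl b hb hx a ha ha'
    exact hl b hb ((h x b hb).1 hx) a ha ((h a b hb).1 ha')

/-- The set `T` is right-flushed in the rows below `k`: each of its rows is a nonempty terminal
segment of the live columns of the row, and there are no points in other rows. -/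
structure FlushBelow (ν : LatticePath) (k : ℕ) (T : Finset (ℕ × ℕ)) : Prop where
  subset : T ⊆ A ν
  lt : ∀ {x y}, (x, y) ∈ T → y < k
  live : ∀ {x y}, (x, y) ∈ T → Live T x y
  up : ∀ {x c y}, (x, y) ∈ T → x < c → c ≤ rowEnd ν y → Live T c y → (c, y) ∈ T
  nonempty : ∀ y < k, ∃ x, (x, y) ∈ T

/-- A set that is right-flushed in all rows and whose top row consists of all live columns. -/
structure Flush (ν : LatticePath) (T : Finset (ℕ × ℕ)) : Prop
    extends FlushBelow ν (height ν + 1) T where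
  top : ∀ x ≤ width ν, Live T x (height ν) → (x, height ν) ∈ T

theorem FlushBelow.le_rowEnd {ν : LatticePath} {k : ℕ} {T : Finset (ℕ × ℕ)}
    (h : FlushBelow ν k T) {x y : ℕ} (hx : (x, y) ∈ T) : x ≤ rowEnd ν y :=
  (mem_A.1 (h.subset hx)).2

/-- A live column of a flush set is used again. -/
theorem Flush.exists_mem {ν : LatticePath} {T : Finset (ℕ × ℕ)} (h : Flush ν T) {x y : ℕ}
    (hx : x ≤ width ν) (hl : Live T x y) (hy : y ≤ height ν) : ∃ b, y ≤ b ∧ (x, b) ∈ T := by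
  by_cases hn : Live T x (height ν)
  · exact ⟨_, hy, h.top x hx hn⟩
  · simp only [Live] at hn
    push Not at hn
    obtain ⟨b, -, hxb, a, ha, hab⟩ := hn
    refine ⟨b, ?_, hxb⟩
    by_contra! hb
    exact hl b hb hxb a ha hab

theorem IsNuTree.flush {ν : LatticePath} {T : Finset (ℕ × ℕ)} (hT : IsNuTree ν T) :
    Flush ν T := by
  obtain ⟨h1, h2, h3⟩ := isNuTree_iff.1 hT
  have hle : ∀ {x y}, (x, y) ∈ T → x ≤ rowEnd ν y := fun hx => (mem_A.1 (h1 hx)).2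
  have hlive : ∀ {x y}, (x, y) ∈ T → Live T x y := by
    intro x y hx b hb hxb a ha hab
    exact h2 _ hab _ hx ⟨ha, hb, hle hxb⟩
  -- A point in a live column is compatible with all points below it.
  have hup : ∀ y, (∀ x c, (x, y) ∈ T → x < c → c ≤ rowEnd ν y → Live T c y → (c, y) ∈ T) := by
    intro y
    induction y using Nat.strong_induction_on with
    | _ y ih =>
      intro x c hx hxc hc hl
      by_contra hcT
      obtain ⟨⟨a, b⟩, ht, h | h⟩ := h3 (c, y) (mem_A.2 ⟨(mem_A.1 (h1 hx)).1, hc⟩) hcT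
      · exact h2 _ hx _ ht ⟨hxc.trans h.1, h.2.1, h.2.2⟩
      · obtain ⟨e1, e2, e3⟩ := h
        simp only at e1 e2 e3
        exact hl b e2 (ih b e2 a c ht e1 e3 (hl.anti e2.le)) a e1 ht
  refine ⟨⟨h1, fun hx => Nat.lt_succ_of_le (mem_A.1 (h1 hx)).1, hlive,
    fun {x c y} => hup y x c, ?_⟩, ?_⟩
  · intro y hy
    classical
    by_contra! hcon
    let s := (Finset.range (rowEnd ν y + 1)).filter (fun x => Live T x y)
    have hs : s.Nonempty := ⟨0, by simp [s, live_zero]⟩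
    have hc := s.max'_mem hs
    have hmax := s.le_max'
    set c := s.max' hs
    simp only [s, Finset.mem_filter, Finset.mem_range] at hc
    obtain ⟨⟨a, b⟩, ht, h | h⟩ := h3 (c, y) (mem_A.2 ⟨by omega, by omega⟩) (hcon c)
    · obtain ⟨e1, e2, e3⟩ := h
      simp only at e1 e2 e3
      have := hmax a (by
        simp only [s, Finset.mem_filter, Finset.mem_range]
        exact ⟨by omega, (hlive ht).anti e2.le⟩)
      omega
    · obtain ⟨e1, e2, e3⟩ := h
      simp only at e1 e2 e3
      exact hc.2 b e2 (hup b a c ht e1 e3 (hc.2.anti e2.le)) a e1 ht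
  · intro x hx hl
    have h0 : (0, height ν) ∈ T := by
      by_contra h0
      obtain ⟨t, ht, h | h⟩ := h3 (0, height ν) (mem_A.2 ⟨le_rfl, by omega⟩) h0
      · have := (mem_A.1 (h1 ht)).1
        have := h.2.1
        simp only at *
        omega
      · exact absurd h.1 (Nat.not_lt_zero _)
    rcases Nat.eq_zero_or_pos x with rfl | hx0
    · exact h0
    · exact hup _ 0 x h0 hx0 (by rwa [rowEnd_of_height_le le_rfl]) hl

theorem Flush.isNuTree {ν : LatticePath} {T : Finset (ℕ × ℕ)} (h : Flush ν T) :
    IsNuTree ν T := by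
  refine isNuTree_iff.2 ⟨h.subset, ?_, ?_⟩
  · rintro ⟨a, b⟩ hp ⟨c, y⟩ hq ⟨e1, e2, e3⟩
    simp only at e1 e2 e3
    exact h.live hq b e2 (h.up hp e1 e3 ((h.live hq).anti e2.le)) a e1 hp
  · rintro ⟨c, y⟩ hr hrT
    have hc := mem_A.1 hr
    by_cases hl : Live T c y
    · obtain ⟨x, hx, hmin⟩ : ∃ x, (x, y) ∈ T ∧ ∀ a < x, (a, y) ∉ T := by
        classical
        have hex := h.nonempty y (by omega)
        exact ⟨Nat.find hex, Nat.find_spec hex, fun a ha => Nat.find_min hex ha⟩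
      have hcx : c < x := by
        by_contra! hxc
        rcases hxc.eq_or_lt with rfl | hxc
        · exact hrT hx
        · exact hrT (h.up hx hxc hc.2 hl)
      have hxR := h.le_rowEnd hx
      have hyn : y < height ν := by
        by_contra! hyn
        obtain rfl : y = height ν := by omega
        exact hrT (h.top c (hc.2.trans (rowEnd_le_width _ _)) hl)
      obtain ⟨b, hb, hxb⟩ := h.exists_mem (x := x) (y := y + 1)
        (hxR.trans (rowEnd_le_width _ _)) (by
          intro b hb hxb a ha
          rcases Nat.lt_succ_iff_lt_or_eq.1 hb with hb | rfl
          · exact h.live hx b hb hxb a ha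
          · exact hmin a ha) hyn
      exact ⟨(x, b), hxb, Or.inl ⟨hcx, hb, hxR⟩⟩
    · simp only [Live] at hl
      push Not at hl
      obtain ⟨b, hb, hcb, a, ha, hab⟩ := hl
      exact ⟨(a, b), hab, Or.inr ⟨ha, hb, h.le_rowEnd hcb⟩⟩

theorem isNuTree_iff_flush {ν : LatticePath} {T : Finset (ℕ × ℕ)} :
    IsNuTree ν T ↔ Flush ν T :=
  ⟨IsNuTree.flush, Flush.isNuTree⟩

/-! ### Counting the points in the rows of a `ν`-tree -/

/-- The abscissae of the points of `T` at height `y`. -/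
def row (T : Finset (ℕ × ℕ)) (y : ℕ) : Finset ℕ := (T.filter fun p => p.2 = y).image Prod.fst

@[simp] theorem mem_row {T : Finset (ℕ × ℕ)} {x y : ℕ} : x ∈ row T y ↔ (x, y) ∈ T := by
  simp [row]

/-- The number of columns that are no longer live at height `y`, if `T` is right-flushed. -/
def dead (T : Finset (ℕ × ℕ)) (y : ℕ) : ℕ := ∑ z ∈ Finset.range y, ((row T z).card - 1)

theorem dead_succ (T : Finset (ℕ × ℕ)) (y : ℕ) :
    dead T (y + 1) = dead T y + ((row T y).card - 1) := Finset.sum_range_succ _ _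

open Classical in
/-- The live columns at height `y` with abscissa at most `r`. -/
noncomputable def liveTo (T : Finset (ℕ × ℕ)) (y r : ℕ) : Finset ℕ :=
  (Finset.range (r + 1)).filter fun x => Live T x y

theorem mem_liveTo {T : Finset (ℕ × ℕ)} {x y r : ℕ} :
    x ∈ liveTo T y r ↔ x ≤ r ∧ Live T x y := by
  simp [liveTo]

/-- Two terminal segments of a finite set with the same number of elements agree. -/
theorem eq_of_terminal {s U V : Finset ℕ} (hU : U ⊆ s) (hV : V ⊆ s)
    (hU' : ∀ x ∈ U, ∀ c ∈ s, x < c → c ∈ U) (hV' : ∀ x ∈ V, ∀ c ∈ s, x < c → c ∈ V)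
    (h : U.card = V.card) : U = V := by
  by_cases hUV : U ⊆ V
  · exact Finset.eq_of_subset_of_card_le hUV h.ge
  · obtain ⟨x, hx, hxV⟩ := Finset.not_subset.1 hUV
    refine (Finset.eq_of_subset_of_card_le (fun c hc => ?_) h.le).symm
    rcases lt_trichotomy x c with hxc | rfl | hxc
    · exact hU' x hx c (hV hc) hxc
    · exact hx
    · exact absurd (hV' c hc x (hU hx) hxc) hxV

theorem exists_terminal (s : Finset ℕ) {k : ℕ} (hk : k ≤ s.card) :
    ∃ U ⊆ s, U.card = k ∧ ∀ x ∈ U, ∀ c ∈ s, x < c → c ∈ U := by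
  induction k with
  | zero => exact ⟨∅, by simp, rfl, by simp⟩
  | succ k ih =>
    obtain ⟨U, h1, h2, h3⟩ := ih (by omega)
    have hne : (s \ U).Nonempty := by
      rw [← Finset.card_pos, Finset.card_sdiff_of_subset h1]
      omega
    have hm := (s \ U).max'_mem hne
    have hmax := (s \ U).le_max'
    set m := (s \ U).max' hne
    rw [Finset.mem_sdiff] at hm
    refine ⟨insert m U, Finset.insert_subset hm.1 h1, by rw [Finset.card_insert_of_notMem hm.2, h2],
      fun x hx c hc hxc => ?_⟩
    by_cases hcU : c ∈ U
    · exact Finset.mem_insert_of_mem hcU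
    · rcases Finset.mem_insert.1 hx with rfl | hx
      · have := hmax c (Finset.mem_sdiff.2 ⟨hc, hcU⟩)
        omega
      · exact absurd (h3 x hx c hc hxc) hcU

namespace FlushBelow

variable {ν : LatticePath} {k : ℕ} {T : Finset (ℕ × ℕ)}

theorem row_subset_liveTo (h : FlushBelow ν k T) (y : ℕ) :
    row T y ⊆ liveTo T y (rowEnd ν y) := by
  intro x hx
  rw [mem_row] at hx
  exact mem_liveTo.2 ⟨h.le_rowEnd hx, h.live hx⟩

theorem exists_min (h : FlushBelow ν k T) {y : ℕ} (hy : y < k) :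
    ∃ x, (x, y) ∈ T ∧ ∀ a < x, (a, y) ∉ T := by
  classical
  have hex := h.nonempty y hy
  exact ⟨Nat.find hex, Nat.find_spec hex, fun a ha => Nat.find_min hex ha⟩

theorem live_succ_iff {x y m : ℕ} (hm : (m, y) ∈ T) (hmin : ∀ a < m, (a, y) ∉ T) :
    Live T x (y + 1) ↔ Live T x y ∧ ((x, y) ∈ T → x = m) := by
  constructor
  · refine fun hl => ⟨hl.anti (Nat.le_succ y), fun hx => ?_⟩
    by_contra hne
    rcases Nat.lt_or_gt_of_ne hne with hlt | hlt
    · exact hmin x hlt hx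
    · exact hl y (Nat.lt_succ_self y) hx m hlt hm
  · rintro ⟨hl, hx⟩ b hb hxb a ha
    rcases Nat.lt_succ_iff_lt_or_eq.1 hb with hb | rfl
    · exact hl b hb hxb a ha
    · rw [hx hxb] at ha
      exact hmin a ha

theorem one_le_card_row (h : FlushBelow ν k T) {y : ℕ} (hy : y < k) : 1 ≤ (row T y).card := by
  obtain ⟨x, hx⟩ := h.nonempty y hy
  exact Finset.card_pos.2 ⟨x, mem_row.2 hx⟩

/-- The number of live columns in a row. -/
theorem card_liveTo (h : FlushBelow ν k T) {y r : ℕ} (hy : y ≤ k)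
    (hr : ∀ z < y, rowEnd ν z ≤ r) : (liveTo T y r).card + dead T y = r + 1 := by
  induction y with
  | zero =>
    have : liveTo T 0 r = Finset.range (r + 1) := by
      ext x
      simp [mem_liveTo, Live]
    simp [this, dead]
  | succ y ih =>
    have ih := ih (by omega) (fun z hz => hr z (by omega))
    obtain ⟨m, hm, hmin⟩ := h.exists_min (show y < k by omega)
    have e : liveTo T (y + 1) r = liveTo T y r \ (row T y).erase m := by
      ext x
      simp only [mem_liveTo, Finset.mem_sdiff, Finset.mem_erase, mem_row,
        live_succ_iff hm hmin]
      tauto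
    have hsub : (row T y).erase m ⊆ liveTo T y r := by
      refine (Finset.erase_subset _ _).trans ((h.row_subset_liveTo y).trans fun x hx => ?_)
      rw [mem_liveTo] at hx ⊢
      exact ⟨hx.1.trans (hr y (Nat.lt_succ_self y)), hx.2⟩
    have hcard := Finset.card_le_card hsub
    rw [e, Finset.card_sdiff_of_subset hsub, dead_succ]
    rw [Finset.card_erase_of_mem (mem_row.2 hm)] at hcard ⊢
    omega

/-- A right-flushed set is determined by the numbers of points in its rows. -/
theorem eq_of_card_row {T' : Finset (ℕ × ℕ)} (h : FlushBelow ν k T) (h' : FlushBelow ν k T')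
    (hc : ∀ y < k, (row T y).card = (row T' y).card) : T = T' := by
  have key : ∀ y < k, row T y = row T' y := by
    intro y
    induction y using Nat.strong_induction_on with
    | _ y ih =>
      intro hy
      have hl := live_congr (T := T) (T' := T') (y := y) fun x b hb => by
        rw [← mem_row, ← mem_row, ih b hb (by omega)]
      refine eq_of_terminal (s := liveTo T y (rowEnd ν y)) (h.row_subset_liveTo y) ?_ ?_ ?_
        (hc y hy)
      · intro x hx
        have := mem_liveTo.1 (h'.row_subset_liveTo y hx)
        exact mem_liveTo.2 ⟨this.1, (hl x).2 this.2⟩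
      · intro x hx c hcl hxc
        rw [mem_liveTo] at hcl
        exact mem_row.2 (h.up (mem_row.1 hx) hxc hcl.1 hcl.2)
      · intro x hx c hcl hxc
        rw [mem_liveTo] at hcl
        exact mem_row.2 (h'.up (mem_row.1 hx) hxc hcl.1 ((hl c).1 hcl.2))
  ext ⟨x, y⟩
  constructor
  · intro hx
    rw [← mem_row, ← key y (h.lt hx)]
    exact mem_row.2 hx
  · intro hx
    rw [← mem_row, key y (h'.lt hx)]
    exact mem_row.2 hx

end FlushBelow

/-- There are right-flushed sets with prescribed numbers of dead columns at all heights. -/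
theorem exists_flushBelow {ν : LatticePath} (S : ℕ → ℕ) (k : ℕ) (hk : k ≤ height ν + 1)
    (h0 : S 0 = 0) (hS : ∀ y < k, S y ≤ S (y + 1)) (hR : ∀ y < k, S (y + 1) ≤ rowEnd ν y) :
    ∃ T, FlushBelow ν k T ∧ ∀ y ≤ k, dead T y = S y := by
  induction k with
  | zero =>
    refine ⟨∅, ⟨by simp, by simp, by simp, by simp, by simp⟩, fun y hy => ?_⟩
    obtain rfl : y = 0 := by omega
    simp [dead, h0]
  | succ k ih =>
    obtain ⟨T, hT, hd⟩ := ih (by omega) (fun y hy => hS y (by omega)) (fun y hy => hR y (by omega))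
    have hcard := hT.card_liveTo (y := k) (r := rowEnd ν k) le_rfl
      (fun z hz => rowEnd_mono ν hz.le)
    have e1 := hS k (by omega)
    have e2 := hR k (by omega)
    have e3 := hd k le_rfl
    obtain ⟨U, hU, hU', hU''⟩ := exists_terminal (liveTo T k (rowEnd ν k))
      (k := S (k + 1) - S k + 1) (by omega)
    set T' := T ∪ U.image fun x => (x, k) with hT'
    have hmem : ∀ {x y}, (x, y) ∈ T' ↔ (x, y) ∈ T ∨ (x ∈ U ∧ y = k) := by
      intro x y
      simp only [hT', Finset.mem_union, Finset.mem_image, Prod.mk.injEq]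
      constructor
      · rintro (h | ⟨a, ha, rfl, rfl⟩)
        · exact Or.inl h
        · exact Or.inr ⟨ha, rfl⟩
      · rintro (h | ⟨ha, rfl⟩)
        · exact Or.inl h
        · exact Or.inr ⟨x, ha, rfl, rfl⟩
    have hlt : ∀ {x y}, y < k → ((x, y) ∈ T ↔ (x, y) ∈ T') := by
      intro x y hy
      rw [hmem]
      exact ⟨Or.inl, fun h => h.resolve_right (by omega)⟩
    have hl : ∀ {x y}, y ≤ k → (Live T x y ↔ Live T' x y) := fun {x y} hy =>
      live_congr (fun a b hb => hlt (by omega)) x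
    have hk' : ∀ {x}, (x, k) ∈ T' ↔ x ∈ U := by
      intro x
      rw [hmem]
      exact ⟨fun h => h.elim (fun h => absurd (hT.lt h) (lt_irrefl _)) And.left,
        fun h => Or.inr ⟨h, rfl⟩⟩
    have hrow : row T' k = U := by
      ext x
      rw [mem_row, hk']
    refine ⟨T', ⟨?_, ?_, ?_, ?_, ?_⟩, ?_⟩
    · rintro ⟨x, y⟩ hx
      rcases hmem.1 hx with hx' | ⟨hx', rfl⟩
      · exact hT.subset hx'
      · exact mem_A.2 ⟨by omega, (mem_liveTo.1 (hU hx')).1⟩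
    · intro x y hx
      rcases hmem.1 hx with hx' | ⟨hx', rfl⟩
      · exact (hT.lt hx').trans (Nat.lt_succ_self _)
      · exact Nat.lt_succ_self _
    · intro x y hx
      rcases hmem.1 hx with hx' | ⟨hx', rfl⟩
      · exact (hl (hT.lt hx').le).1 (hT.live hx')
      · exact (hl le_rfl).1 (mem_liveTo.1 (hU hx')).2
    · intro x c y hx hxc hc hcl
      rcases hmem.1 hx with hx' | ⟨hx', rfl⟩
      · exact hmem.2 (Or.inl (hT.up hx' hxc hc ((hl (hT.lt hx').le).2 hcl)))
      · exact hmem.2 (Or.inr ⟨hU'' x hx' c (mem_liveTo.2 ⟨hc, (hl le_rfl).2 hcl⟩) hxc, rfl⟩)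
    · intro y hy
      rcases Nat.lt_succ_iff_lt_or_eq.1 hy with hy | rfl
      · obtain ⟨x, hx⟩ := hT.nonempty y hy
        exact ⟨x, (hlt hy).1 hx⟩
      · obtain ⟨x, hx⟩ : U.Nonempty := by
          rw [← Finset.card_pos]
          omega
        exact ⟨x, hk'.2 hx⟩
    · have hdead : ∀ y ≤ k, dead T' y = S y := by
        intro y hy
        rw [← hd y hy]
        refine Finset.sum_congr rfl fun z hz => ?_
        rw [Finset.mem_range] at hz
        have : row T' z = row T z := by
          ext x
          rw [mem_row, mem_row, hlt (show z < k by omega)]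
        rw [this]
      intro y hy
      rcases Nat.lt_succ_iff_lt_or_eq.1 (Nat.lt_succ_of_le hy) with hy | rfl
      · exact hdead y (by omega)
      · rw [dead_succ, hdead k le_rfl, hrow, hU']
        omega

/-- The tree of a `ν`-path has one more point in each row than the path has east steps. -/
theorem NuPath.exists_flush {ν : LatticePath} (μ : NuPath ν) :
    ∃ T, Flush ν T ∧ ∀ y ≤ height ν, dead T (y + 1) = rowEnd μ.word y := by
  obtain ⟨T, hT, hd⟩ := exists_flushBelow (ν := ν)
    (fun y => if y = 0 then 0 else rowEnd μ.word (y - 1)) (height ν + 1) le_rfl (by simp)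
    (fun y _ => by
      by_cases hy : y = 0
      · simp [hy]
      · simpa [hy] using rowEnd_mono _ (by omega))
    (fun y hy => by simpa using μ.rowEnd_le (by omega))
  refine ⟨T, ⟨hT, fun x hx hl => ?_⟩, fun y hy => by simpa using hd (y + 1) (by omega)⟩
  have e0 := rowEnd_of_height_le (le_refl (height ν))
  have e1 := hT.card_liveTo (y := height ν) (r := width ν) (by omega)
    (fun z _ => rowEnd_le_width ν z)
  have e2 := hd (height ν + 1) le_rfl
  have e3 := hT.one_le_card_row (Nat.lt_succ_self (height ν))
  have e4 := hT.row_subset_liveTo (height ν)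
  have e5 := μ.rowEnd_top
  rw [e0] at e4
  rw [dead_succ] at e2
  simp only [Nat.add_one_ne_zero, if_false, Nat.add_sub_cancel] at e2
  have := Finset.eq_of_subset_of_card_le e4 (by omega)
  rw [← mem_row, this]
  exact mem_liveTo.2 ⟨hx, hl⟩

theorem Flush.exists_nuPath {ν : LatticePath} {T : Finset (ℕ × ℕ)} (hT : Flush ν T) :
    ∃ μ : NuPath ν, ∀ y ≤ height ν, dead T (y + 1) = rowEnd μ.word y := by
  obtain ⟨μ, hμ⟩ := NuTamari.exists_nuPath ν (fun y => dead T (y + 1))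
    (fun y _ => by simp only [dead_succ T (y + 1)]; omega) (fun y hy => by
      have e1 := hT.card_liveTo (y := y + 1) (r := rowEnd ν y) (by omega)
        (fun z hz => rowEnd_mono ν (by omega))
      have e2 : 0 < (liveTo T (y + 1) (rowEnd ν y)).card :=
        Finset.card_pos.2 ⟨0, mem_liveTo.2 ⟨Nat.zero_le _, live_zero _ _⟩⟩
      omega) (by
      have e1 := hT.card_liveTo (y := height ν) (r := width ν) (by omega)
        (fun z _ => rowEnd_le_width ν z)
      have e3 := hT.one_le_card_row (Nat.lt_succ_self (height ν))
      have e4 : row T (height ν) = liveTo T (height ν) (width ν) := by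
        refine Finset.Subset.antisymm ?_ fun x hx => ?_
        · rw [← rowEnd_of_height_le (le_refl (height ν))]
          exact hT.row_subset_liveTo _
        · rw [mem_liveTo] at hx
          exact mem_row.2 (hT.top x hx.1 hx.2)
      rw [dead_succ, e4]
      rw [e4] at e3
      omega)
  exact ⟨μ, fun y hy => (hμ y hy).symm⟩

theorem Flush.eq_of_dead {ν : LatticePath} {T T' : Finset (ℕ × ℕ)} (h : Flush ν T)
    (h' : Flush ν T') (hd : ∀ y ≤ height ν, dead T (y + 1) = dead T' (y + 1)) : T = T' := by
  refine h.eq_of_card_row h'.toFlushBelow fun y hy => ?_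
  have e1 := hd y (by omega)
  have e2 : dead T y = dead T' y := by
    cases y with
    | zero => rfl
    | succ y => exact hd y (by omega)
  rw [dead_succ, dead_succ] at e1
  have := h.one_le_card_row hy
  have := h'.one_le_card_row hy
  omega

/-! ### Flips of `ν`-trees -/

/-- The tree `T'` arises from `T` by exchanging the point `i` for the point `j` in a higher row. -/
def FlipAt (T T' : Finset (ℕ × ℕ)) (i j : ℕ × ℕ) : Prop :=
  i ∈ T ∧ j ∈ T' ∧ i.2 < j.2 ∧ T.erase i = T'.erase j

namespace FlipAt

variable {ν : LatticePath} {T T' : Finset (ℕ × ℕ)} {i j : ℕ × ℕ}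

theorem mem_iff (h : FlipAt T T' i j) {p : ℕ × ℕ} (hi : p ≠ i) (hj : p ≠ j) :
    p ∈ T ↔ p ∈ T' := by
  have := congrArg (p ∈ ·) h.2.2.2
  simpa [hi, hj] using this

theorem ne (h : FlipAt T T' i j) : i ≠ j := by
  rintro rfl
  exact lt_irrefl _ h.2.2.1

theorem left_notMem (h : FlipAt T T' i j) : i ∉ T' := by
  intro hi
  have : i ∈ T'.erase j := Finset.mem_erase.2 ⟨h.ne, hi⟩
  rw [← h.2.2.2] at this
  exact Finset.notMem_erase _ _ this

theorem right_notMem (h : FlipAt T T' i j) : j ∉ T := by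
  intro hj
  have : j ∈ T.erase i := Finset.mem_erase.2 ⟨h.ne.symm, hj⟩
  rw [h.2.2.2] at this
  exact Finset.notMem_erase _ _ this

theorem mem_iff_of_row (h : FlipAt T T' i j) {x y : ℕ} (hi : y ≠ i.2) (hj : y ≠ j.2) :
    (x, y) ∈ T ↔ (x, y) ∈ T' :=
  h.mem_iff (fun e => hi (by rw [← e])) (fun e => hj (by rw [← e]))

theorem dead_eq (h : FlipAt T T' i j) (hT : Flush ν T) (hT' : Flush ν T') (y : ℕ)
    (hy : y ≤ height ν + 1) :
    dead T y = dead T' y + if i.2 < y ∧ y ≤ j.2 then 1 else 0 := by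
  have hij := h.2.2.1
  induction y with
  | zero => simp [dead]
  | succ y ih =>
    have ih := ih (by omega)
    have c1 := hT.one_le_card_row (show y < height ν + 1 by omega)
    have c2 := hT'.one_le_card_row (show y < height ν + 1 by omega)
    rw [dead_succ, dead_succ]
    rcases eq_or_ne y i.2 with hi | hi
    · have e : row T' y = (row T y).erase i.1 := by
        ext x
        rw [mem_row, Finset.mem_erase, mem_row]
        rcases eq_or_ne x i.1 with rfl | hx
        · subst hi
          simpa using h.left_notMem
        · rw [h.mem_iff (p := (x, y)) (fun e => hx (by rw [← e]))
            (fun e => by rw [← e] at hij; simp only at hij; omega)]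
          simp [hx]
      have e' : i.1 ∈ row T y := by rw [mem_row, hi]; exact h.1
      have ec : (row T' y).card = (row T y).card - 1 := by rw [e, Finset.card_erase_of_mem e']
      split_ifs at ih ⊢ <;> omega
    · rcases eq_or_ne y j.2 with hj | hj
      · have e : row T y = (row T' y).erase j.1 := by
          ext x
          rw [mem_row, Finset.mem_erase, mem_row]
          rcases eq_or_ne x j.1 with rfl | hx
          · subst hj
            simpa using h.right_notMem
          · rw [h.mem_iff (p := (x, y)) (fun e => by rw [← e] at hij; simp only at hij; omega)
              (fun e => hx (by rw [← e]))]
            simp [hx]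
        have e' : j.1 ∈ row T' y := by rw [mem_row, hj]; exact h.2.1
        have ec : (row T y).card = (row T' y).card - 1 := by rw [e, Finset.card_erase_of_mem e']
        split_ifs at ih ⊢ <;> omega
      · have e : row T y = row T' y := by
          ext x
          rw [mem_row, mem_row, h.mem_iff_of_row hi hj]
        rw [e]
        split_ifs at ih ⊢ <;> omega

/-- The flipped point is the leftmost one of its row, and `j` lies in the next row in which its
column is used. -/
theorem leftmost_and_reused (h : FlipAt T T' i j) (hT : Flush ν T) (hT' : Flush ν T') :
    (∀ a < i.1, (a, i.2) ∉ T) ∧ (∀ z, i.2 < z → z < j.2 → (i.1, z) ∉ T) ∧ (i.1, j.2) ∈ T := by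
  obtain ⟨hi, hj, hij, -⟩ := id h
  have hrow : ∀ {x}, (x, i.2) ∈ T' ↔ (x, i.2) ∈ T ∧ x ≠ i.1 := by
    intro x
    rcases eq_or_ne x i.1 with rfl | hx
    · simpa using h.left_notMem
    · rw [h.mem_iff (p := (x, i.2)) (fun e => hx (by rw [← e]))
        (fun e => by rw [← e] at hij; simp only at hij; omega)]
      simp [hx]
  have hin : i.2 ≤ height ν := (mem_A.1 (hT.subset hi)).1
  have hjn : j.2 ≤ height ν := (mem_A.1 (hT'.subset hj)).1
  have hiR : i.1 ≤ rowEnd ν i.2 := hT.le_rowEnd hi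
  have hliv : ∀ x, Live T x i.2 ↔ Live T' x i.2 :=
    live_congr fun x b hb => h.mem_iff_of_row (by omega) (by omega)
  have hmin : ∀ a < i.1, (a, i.2) ∉ T := by
    intro a ha haT
    have := hT'.up (hrow.2 ⟨haT, ha.ne⟩) ha hiR ((hliv i.1).1 (hT.live hi))
    exact h.left_notMem this
  obtain ⟨x₁, hx₁, hmin₁⟩ := hT'.exists_min (show i.2 < height ν + 1 by omega)
  have hx₁T := (hrow.1 hx₁).1
  have hlt : i.1 < x₁ := by
    by_contra! hcon
    exact hmin x₁ (lt_of_le_of_ne hcon (hrow.1 hx₁).2) hx₁T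
  have hx₁R := hT'.le_rowEnd hx₁
  -- the column of `x₁` is dead in `T` above the row of `i`
  have hdead : ∀ z, i.2 < z → (x₁, z) ∉ T := fun z hz hzT =>
    hT.live hzT i.2 hz hx₁T i.1 hlt hi
  have hl₁ : Live T' x₁ (i.2 + 1) :=
    (FlushBelow.live_succ_iff hx₁ hmin₁).2 ⟨hT'.live hx₁, fun _ => rfl⟩
  have hl₀ : Live T i.1 (i.2 + 1) :=
    (FlushBelow.live_succ_iff hi hmin).2 ⟨hT.live hi, fun _ => rfl⟩
  have hgap : ∀ z, i.2 < z → z < j.2 → (x₁, z) ∉ T' := fun z h1 h2 hz =>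
    hdead z h1 ((h.mem_iff_of_row (by omega) (by omega)).2 hz)
  have hl₁' : ∀ z, z ≤ j.2 → Live T' x₁ z := by
    intro z hz b hb hb'
    rcases Nat.lt_or_ge i.2 b with hib | hib
    · exact absurd hb' (hgap b hib (by omega))
    · exact hl₁ b (by omega) hb'
  have hbetween : ∀ z, i.2 < z → z < j.2 → (i.1, z) ∉ T := by
    intro z h1 h2 hz
    have hz' := (h.mem_iff_of_row (by omega) (by omega)).1 hz
    exact hgap z h1 h2 (hT'.up hz' hlt (hx₁R.trans (rowEnd_mono ν h1.le)) (hl₁' z h2.le))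
  refine ⟨hmin, hbetween, ?_⟩
  by_contra hcon
  obtain ⟨b, hb, hbT⟩ := hT.exists_mem (hiR.trans (rowEnd_le_width _ _)) hl₀ (by omega)
  have hbj : j.2 < b := by
    rcases lt_trichotomy b j.2 with hlt' | rfl | hlt'
    · exact absurd hbT (hbetween b hb hlt')
    · exact absurd hbT hcon
    · exact hlt'
  have hbn : b ≤ height ν := (mem_A.1 (hT.subset hbT)).1
  -- the column of `x₁` is used in `T'` in the row of `j`
  obtain ⟨c, hc, hcT'⟩ := hT'.exists_mem (hx₁R.trans (rowEnd_le_width _ _)) hl₁ (by omega)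
  obtain rfl : c = j.2 := by
    rcases lt_trichotomy c j.2 with hlt' | he | hlt'
    · exact absurd hcT' (hgap c hc hlt')
    · exact he
    · exact absurd ((h.mem_iff_of_row (by omega) (by omega)).2 hcT') (hdead c hc)
  obtain ⟨a, ha, hamin⟩ := hT.exists_min (show j.2 < height ν + 1 by omega)
  have hai : i.1 < a := by
    by_contra! hai
    rcases hai.eq_or_lt with rfl | hai
    · exact hcon ha
    · exact hcon (hT.up ha hai (hiR.trans (rowEnd_mono ν hij.le)) ((hT.live hbT).anti hbj.le))
  have haR : rowEnd ν i.2 < a := by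
    by_contra! haR
    have hla := (hT.live ha).anti (show i.2 + 1 ≤ j.2 by omega)
    have := hT.up hi hai haR (hla.anti (Nat.le_succ _))
    exact hla i.2 (Nat.lt_succ_self _) this i.1 hai hi
  have hla : Live T a (j.2 + 1) :=
    (FlushBelow.live_succ_iff ha hamin).2 ⟨hT.live ha, fun _ => rfl⟩
  obtain ⟨d, hd, hdT⟩ := hT.exists_mem ((hT.le_rowEnd ha).trans (rowEnd_le_width _ _)) hla
    (by omega)
  have haT' : (a, j.2) ∈ T' := by
    refine (h.mem_iff (fun e => ?_) (fun e => ?_)).1 ha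
    · rw [← e] at hij
      exact lt_irrefl _ hij
    · exact h.right_notMem (e ▸ ha)
  exact hT'.live ((h.mem_iff_of_row (by omega) (by omega)).1 hdT) j.2 hd haT' x₁ (by omega) hcT'

/-- In a row `z` after the row `y` of `i`, up to the row of `j`, there are `R z - R y` live columns
to the right of `i`, less the columns that died in between. The row has at most this number of points
exactly if it does not use the column of `i`, and this compares the distances to `ν`. -/
theorem rowCover (h : FlipAt T T' i j) (hT : Flush ν T) (hT' : Flush ν T') :
    RowCover (height ν) (rowEnd ν) (fun y => dead T (y + 1)) (fun y => dead T' (y + 1))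
      i.2 j.2 := by
  obtain ⟨hi, hj, hij, -⟩ := id h
  obtain ⟨hmin, hbetween, hnext⟩ := h.leftmost_and_reused hT hT'
  have hjn : j.2 ≤ height ν := (mem_A.1 (hT'.subset hj)).1
  have hiR : i.1 ≤ rowEnd ν i.2 := hT.le_rowEnd hi
  have hl₀ : ∀ z ≤ j.2, Live T i.1 z := fun z hz => (hT.live hnext).anti hz
  -- no point between the two rows lies weakly left of the column of `i`
  have hleft : ∀ z, i.2 < z → z < j.2 → ∀ a ≤ i.1, (a, z) ∉ T := by
    intro z h1 h2 a ha haT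
    rcases ha.eq_or_lt with rfl | ha
    · exact hbetween z h1 h2 haT
    · exact hbetween z h1 h2 (hT.up haT ha (hiR.trans (rowEnd_mono ν h1.le)) (hl₀ z h2.le))
  have hstart : liveTo T (i.2 + 1) (rowEnd ν i.2) = liveTo T (i.2 + 1) i.1 := by
    ext x
    rw [mem_liveTo, mem_liveTo]
    refine ⟨fun hx => ⟨?_, hx.2⟩, fun hx => ⟨hx.1.trans hiR, hx.2⟩⟩
    by_contra! hlt
    have := hT.up hi hlt hx.1 (hx.2.anti (Nat.le_succ _))
    exact hx.2 i.2 (Nat.lt_succ_self _) this i.1 hlt hi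
  have hconst : ∀ z, i.2 < z → z ≤ j.2 → liveTo T z i.1 = liveTo T (i.2 + 1) i.1 := by
    intro z h1 h2
    ext x
    rw [mem_liveTo, mem_liveTo]
    refine ⟨fun hx => ⟨hx.1, hx.2.anti h1⟩, fun hx => ⟨hx.1, fun b hb hxb => ?_⟩⟩
    rcases Nat.lt_or_ge i.2 b with hib | hib
    · exact absurd hxb (hleft b hib (by omega) x hx.1)
    · exact hx.2 b (by omega) hxb
  have e0 := hT.card_liveTo (y := i.2 + 1) (r := rowEnd ν i.2) (by omega)
    (fun z hz => rowEnd_mono ν (by omega))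
  rw [hstart] at e0
  have hcount : ∀ z, i.2 < z → z ≤ j.2 → i.1 ≤ rowEnd ν z ∧
      (liveTo T z (rowEnd ν z)).card + dead T z = rowEnd ν z + 1 ∧
      (liveTo T z (rowEnd ν z) \ liveTo T z i.1).card + (liveTo T (i.2 + 1) i.1).card =
        (liveTo T z (rowEnd ν z)).card := by
    intro z h1 h2
    have hz := hiR.trans (rowEnd_mono ν h1.le)
    refine ⟨hz, hT.card_liveTo (by omega) (fun b hb => rowEnd_mono ν hb.le), ?_⟩
    rw [← hconst z h1 h2]
    refine Finset.card_sdiff_add_card_eq_card fun x hx => ?_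
    rw [mem_liveTo] at hx ⊢
    exact ⟨hx.1.trans hz, hx.2⟩
  have hstrict : ∀ z, i.2 < z → z ≤ j.2 →
      ∀ x, x ∈ liveTo T z (rowEnd ν z) \ liveTo T z i.1 ↔
        i.1 < x ∧ x ≤ rowEnd ν z ∧ Live T x z := by
    intro z h1 h2 x
    rw [Finset.mem_sdiff, mem_liveTo, mem_liveTo]
    constructor
    · rintro ⟨⟨h3, h4⟩, h5⟩
      exact ⟨by by_contra! hx; exact h5 ⟨hx, h4⟩, h3, h4⟩
    · rintro ⟨h3, h4, h5⟩
      exact ⟨⟨h4, h5⟩, fun h6 => absurd h6.1 (not_le_of_gt h3)⟩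
  refine ⟨hij, hjn, ?_, ?_, ?_⟩
  · obtain ⟨-, e1, e2⟩ := hcount j.2 hij le_rfl
    have hsub : insert i.1 (liveTo T j.2 (rowEnd ν j.2) \ liveTo T j.2 i.1) ⊆ row T j.2 := by
      intro x hx
      rw [mem_row]
      rcases Finset.mem_insert.1 hx with rfl | hx
      · exact hnext
      · rw [hstrict j.2 hij le_rfl] at hx
        exact hT.up hnext hx.1 hx.2.1 hx.2.2
    have hcard := Finset.card_le_card hsub
    rw [Finset.card_insert_of_notMem
      (by rw [hstrict j.2 hij le_rfl]; exact fun hx => lt_irrefl _ hx.1)] at hcard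
    simp only [dead_succ T j.2]
    omega
  · intro z h1 h2
    obtain ⟨-, e1, e2⟩ := hcount z h1 h2.le
    have hsub : row T z ⊆ liveTo T z (rowEnd ν z) \ liveTo T z i.1 := by
      intro x hx
      rw [mem_row] at hx
      rw [hstrict z h1 h2.le]
      refine ⟨?_, hT.le_rowEnd hx, hT.live hx⟩
      by_contra! hxi
      exact hleft z h1 h2 x hxi hx
    have hcard := Finset.card_le_card hsub
    have := hT.one_le_card_row (show z < height ν + 1 by omega)
    simp only [dead_succ T z]
    omega
  · intro z hz
    have := h.dead_eq hT hT' (z + 1) (by omega)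
    simp only [this]
    congr 1
    exact if_congr (by omega) rfl rfl

end FlipAt

/-- The leftmost point of a row that is not the top row can be flipped, unless it is the only
point of its row. -/
theorem Flush.exists_flipAt {ν : LatticePath} {T : Finset (ℕ × ℕ)} (hT : Flush ν T) {y : ℕ}
    (hy : y < height ν) (hc : 2 ≤ (row T y).card) :
    ∃ T', Flush ν T' ∧ ∃ i j, FlipAt T T' i j ∧ i.2 = y := by
  obtain ⟨x₀, hx₀, hmin⟩ := hT.exists_min (show y < height ν + 1 by omega)
  obtain ⟨x₁, hx₁, hlt, hmin₁⟩ : ∃ x₁, (x₁, y) ∈ T ∧ x₀ < x₁ ∧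
      ∀ a, x₀ < a → a < x₁ → (a, y) ∉ T := by
    classical
    have hex : ∃ x₁, (x₁, y) ∈ T ∧ x₀ < x₁ := by
      obtain ⟨x, hx, hne⟩ := Finset.exists_mem_ne (by omega : 1 < (row T y).card) x₀
      rw [mem_row] at hx
      refine ⟨x, hx, lt_of_le_of_ne ?_ hne.symm⟩
      by_contra! hlt
      exact hmin x hlt hx
    exact ⟨Nat.find hex, (Nat.find_spec hex).1, (Nat.find_spec hex).2,
      fun a h1 h2 h3 => Nat.find_min hex h2 ⟨h3, h1⟩⟩
  have hR₀ := hT.le_rowEnd hx₀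
  have hR₁ := hT.le_rowEnd hx₁
  obtain ⟨z, hz, hxz, hzmin⟩ : ∃ z, y < z ∧ (x₀, z) ∈ T ∧ ∀ b, y < b → b < z → (x₀, b) ∉ T := by
    classical
    have hex := hT.exists_mem (hR₀.trans (rowEnd_le_width _ _))
      ((FlushBelow.live_succ_iff hx₀ hmin).2 ⟨hT.live hx₀, fun _ => rfl⟩) hy
    exact ⟨Nat.find hex, (Nat.find_spec hex).1, (Nat.find_spec hex).2,
      fun b h1 h2 h3 => Nat.find_min hex h2 ⟨h1, h3⟩⟩
  obtain ⟨h1, h2, h3⟩ := isNuTree_iff.1 hT.isNuTree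
  have hzn : z ≤ height ν := (mem_A.1 (h1 hxz)).1
  have hj : (x₁, z) ∉ T := fun h => h2 _ hx₀ _ h ⟨hlt, hz, hR₁⟩
  set T' := insert (x₁, z) (T.erase (x₀, y)) with hT'
  have hmem : ∀ {p}, p ∈ T' ↔ p = (x₁, z) ∨ p ≠ (x₀, y) ∧ p ∈ T := by simp [hT']
  have hmono : ∀ {b c : ℕ}, b ≤ c → rowEnd ν b ≤ rowEnd ν c := fun h => rowEnd_mono ν h
  -- columns strictly between `x₀` and `x₁` are blocked from below the row `y`
  have hblock : ∀ a, x₀ < a → a < x₁ → ∃ a' b', b' < y ∧ (a', b') ∈ T ∧ a' < a ∧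
      a ≤ rowEnd ν b' := by
    intro a h4 h5
    by_contra! hcon
    refine hmin₁ a h4 h5 (hT.up hx₀ h4 (by omega) fun b hb hab a' ha' ha'b => ?_)
    exact absurd (hT.le_rowEnd hab) (not_le_of_gt (hcon a' b hb ha'b ha'))
  have hnew : ∀ t ∈ T, t ≠ (x₀, y) → ¬ SW ν t (x₁, z) ∧ ¬ SW ν (x₁, z) t := by
    rintro ⟨a, b⟩ ht hne
    have hab : ∀ q ∈ T, ¬ SW ν (a, b) q := fun q hq => h2 _ ht q hq
    refine ⟨?_, ?_⟩
    · rintro ⟨e1, e2, e3⟩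
      simp only at e1 e2 e3
      rcases lt_trichotomy b y with hb | rfl | hb
      · exact hab _ hx₁ ⟨e1, hb, e3⟩
      · rcases lt_trichotomy a x₀ with ha | rfl | ha
        · exact hmin a ha ht
        · exact hne rfl
        · exact hmin₁ a ha e1 ht
      · rcases lt_trichotomy a x₀ with ha | rfl | ha
        · exact hab _ hxz ⟨ha, e2, by have := hmono hb.le; simp only; omega⟩
        · exact hzmin b hb e2 ht
        · exact h2 _ hx₀ _ ht ⟨ha, hb, by simp only; omega⟩
    · rintro ⟨e1, e2, e3⟩
      exact h2 _ hxz _ ht ⟨hlt.trans e1, e2, e3⟩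
  have hrr : ∀ r, ¬ SW ν r r := fun r h => lt_irrefl _ h.1
  have hT'tree : IsNuTree ν T' := by
    refine isNuTree_iff.2 ⟨?_, ?_, ?_⟩
    · intro p hp
      rcases hmem.1 hp with rfl | hp
      · exact mem_A.2 ⟨hzn, hR₁.trans (hmono hz.le)⟩
      · exact h1 hp.2
    · intro p hp q hq
      rcases hmem.1 hp with rfl | hp <;> rcases hmem.1 hq with rfl | hq
      · exact hrr _
      · exact (hnew q hq.2 hq.1).2
      · exact (hnew p hp.2 hp.1).1
      · exact h2 p hp.2 q hq.2
    · intro r hr hrT'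
      by_cases hri : r = (x₀, y)
      · exact ⟨_, hmem.2 (Or.inl rfl), Or.inl (hri ▸ ⟨hlt, hz, hR₁⟩)⟩
      have hrT : r ∉ T := fun h => hrT' (hmem.2 (Or.inr ⟨hri, h⟩))
      have hrj : r ≠ (x₁, z) := fun h => hrT' (hmem.2 (Or.inl h))
      have hz' : (x₀, z) ∈ T' := hmem.2 (Or.inr ⟨by simp; omega, hxz⟩)
      have hy' : (x₁, y) ∈ T' := hmem.2 (Or.inr ⟨by simp; omega, hx₁⟩)
      obtain ⟨t, ht, htr⟩ := h3 r hr hrT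
      by_cases hti : t = (x₀, y)
      · subst hti
        obtain ⟨a, b⟩ := r
        rcases htr with ⟨e1, e2, e3⟩ | ⟨e1, e2, e3⟩
        · simp only at e1 e2 e3
          exact ⟨_, hz', Or.inl ⟨e1, e2.trans hz, e3⟩⟩
        · simp only at e1 e2 e3
          rcases lt_trichotomy a x₁ with ha | rfl | ha
          · obtain ⟨a', b', hb', hmem', ha', haR⟩ := hblock a e1 ha
            exact ⟨(a', b'), hmem.2 (Or.inr ⟨by simp; omega, hmem'⟩),
              Or.inr ⟨ha', by simp only; omega, haR⟩⟩
          · rcases lt_trichotomy b z with hb | rfl | hb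
            · obtain ⟨⟨a', b'⟩, ht', h4 | h4⟩ := h3 (x₀, b)
                (mem_A.2 ⟨by omega, by have := hmono e2.le; omega⟩) (hzmin b e2 hb)
              · obtain ⟨f1, f2, f3⟩ := h4
                simp only at f1 f2 f3
                have : rowEnd ν y < a' := by
                  by_contra! hcon
                  exact h2 _ hx₀ _ ht' ⟨f1, by simp only; omega, hcon⟩
                exact ⟨(a', b'), hmem.2 (Or.inr ⟨by simp; omega, ht'⟩),
                  Or.inl ⟨by simp only; omega, f2, f3⟩⟩
              · obtain ⟨f1, f2, f3⟩ := h4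
                exact absurd ⟨f1, f2.trans hb, f3⟩ (h2 _ ht' _ hxz)
            · exact absurd rfl hrj
            · exact ⟨_, hz', Or.inr ⟨hlt, hb, by have := hmono hz.le; simp only; omega⟩⟩
          · exact ⟨_, hy', Or.inr ⟨ha, e2, e3⟩⟩
      · exact ⟨t, hmem.2 (Or.inr ⟨hti, ht⟩), htr⟩
  refine ⟨T', hT'tree.flush, (x₀, y), (x₁, z), ⟨hx₀, hmem.2 (Or.inl rfl), hz, ?_⟩, rfl⟩
  rw [hT', Finset.erase_insert]
  simp [hj]

theorem RowCover.right_unique {n : ℕ} {R S S' S'' : ℕ → ℕ} {y y' y'' : ℕ}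
    (h : RowCover n R S S' y y') (h' : RowCover n R S S'' y y'') : y' = y'' := by
  rcases lt_trichotomy y' y'' with hlt | he | hlt
  · have := h'.2.2.2.1 y' h.1 hlt
    have := h.2.2.1
    omega
  · exact he
  · have := h.2.2.2.1 y'' h'.1 hlt
    have := h'.2.2.1
    omega

theorem RowCover.congr {n : ℕ} {R S₁ S₁' S₂ S₂' : ℕ → ℕ} {y y' : ℕ}
    (h : RowCover n R S₁ S₁' y y') (e : ∀ z ≤ n, S₁ z = S₂ z) (e' : ∀ z ≤ n, S₁' z = S₂' z) :
    RowCover n R S₂ S₂' y y' := by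
  obtain ⟨h1, h2, h3, h4, h5⟩ := h
  refine ⟨h1, h2, ?_, fun z hz hz' => ?_, fun z hz => ?_⟩
  · rw [← e y (by omega), ← e y' h2]
    exact h3
  · rw [← e y (by omega), ← e z (by omega)]
    exact h4 z hz hz'
  · rw [← e z hz, ← e' z hz]
    exact h5 z hz

/-- The covering relation of the `ν`-Tamari poset corresponds to the flips of `ν`-trees. -/
theorem tamariCover_iff_flipAt {ν : LatticePath} {μ μ' : NuPath ν} {T T' : Finset (ℕ × ℕ)}
    (hT : Flush ν T) (hT' : Flush ν T') (hd : ∀ y ≤ height ν, dead T (y + 1) = rowEnd μ.word y)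
    (hd' : ∀ y ≤ height ν, dead T' (y + 1) = rowEnd μ'.word y) :
    TamariCover μ μ' ↔ ∃ i j, FlipAt T T' i j := by
  constructor
  · intro h
    obtain ⟨y, y', hc⟩ := h.exists_rowCover
    have hy : y < height ν := by
      have := hc.1
      have := hc.2.1
      omega
    have hcard : 2 ≤ (row T y).card := by
      have e1 := hc.2.2.2.2 y hy.le
      rw [if_pos ⟨le_rfl, hc.1⟩, ← hd y hy.le, dead_succ] at e1
      have e2 : dead T y ≤ rowEnd μ'.word y := by
        cases y with
        | zero => simp [dead]
        | succ y =>
          rw [hd y (by omega), hc.2.2.2.2 y (by omega), if_neg (by omega)]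
          exact rowEnd_mono _ (Nat.le_succ y)
      omega
    obtain ⟨T'', hT'', i, j, hf, rfl⟩ := hT.exists_flipAt hy hcard
    have hc' := hf.rowCover hT hT''
    have hc'' := hc.congr (fun z hz => (hd z hz).symm) (fun z hz => (hd' z hz).symm)
    have hjy := hc''.right_unique hc'
    subst hjy
    have : T'' = T' := hT''.eq_of_dead hT' fun z hz => by
      have e1 := hc'.2.2.2.2 z hz
      have e2 := hc''.2.2.2.2 z hz
      simp only at e1 e2
      omega
    exact ⟨i, j, this ▸ hf⟩
  · rintro ⟨i, j, hf⟩
    exact ((hf.rowCover hT hT').congr hd hd').tamariCover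

/-! ### Words in simple transpositions -/

/-- The transposition of `d` and `d + 1`. -/
abbrev sw (d : ℕ) : Equiv.Perm ℕ := Equiv.swap d (d + 1)

/-- The product of a word in simple transpositions of the natural numbers. -/
def ev (l : List ℕ) : Equiv.Perm ℕ := (l.map sw).prod

@[simp] theorem ev_nil : ev [] = 1 := rfl

theorem ev_append (l l' : List ℕ) : ev (l ++ l') = ev l * ev l' := by simp [ev]

@[simp] theorem ev_singleton (d : ℕ) : ev [d] = sw d := by simp [ev]

theorem sw_apply_left (d : ℕ) : sw d d = d + 1 := Equiv.swap_apply_left _ _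

theorem sw_apply_right (d : ℕ) : sw d (d + 1) = d := Equiv.swap_apply_right _ _

theorem sw_apply_of_ne {d i : ℕ} (h : i ≠ d) (h' : i ≠ d + 1) : sw d i = i :=
  Equiv.swap_apply_of_ne_of_ne h h'

theorem mul_sw (g : Equiv.Perm ℕ) {d e : ℕ} (h : g d = e) (h' : g (d + 1) = e + 1) :
    g * sw d = sw e * g := by
  rw [sw, Equiv.mul_swap_eq_swap_mul, h, h']

/-- The Rothe diagram of a permutation of the natural numbers, with rows and columns counted
from `0`. -/
def rotheNat (π : Equiv.Perm ℕ) : Set (ℕ × ℕ) :=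
  {b | ∃ i j, i < j ∧ π j < π i ∧ b = (π j, i)}

/-- Multiplication by a simple transposition on the right adds at most one cell to the Rothe
diagram. -/
theorem rotheNat_mul_sw_subset (π : Equiv.Perm ℕ) (d : ℕ) :
    rotheNat (π * sw d) ⊆
      insert (π d, d) ((fun b : ℕ × ℕ => (b.1, sw d b.2)) '' rotheNat π) := by
  rintro _ ⟨i, j, hij, hlt, rfl⟩
  simp only [Equiv.Perm.mul_apply] at hlt ⊢
  by_cases h : i = d ∧ j = d + 1
  · obtain ⟨rfl, rfl⟩ := h
    rw [sw_apply_right]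
    exact Set.mem_insert _ _
  · refine Set.mem_insert_of_mem _ ⟨(π (sw d j), sw d i), ⟨sw d i, sw d j, ?_, hlt, rfl⟩, ?_⟩
    · simp only [sw, Equiv.swap_apply_def]
      split_ifs <;> omega
    · simp

theorem rotheNat_ev (l : List ℕ) :
    (rotheNat (ev l)).Finite ∧ (rotheNat (ev l)).ncard ≤ l.length := by
  induction l using List.reverseRecOn with
  | nil =>
    have : rotheNat (ev []) = ∅ := by
      ext b
      simp only [rotheNat, ev_nil, Equiv.Perm.one_apply, Set.mem_ofPred_eq, Set.mem_empty_iff_false,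
        iff_false]
      rintro ⟨i, j, h1, h2, -⟩
      omega
    rw [this]
    simp
  | append_singleton l d ih =>
    obtain ⟨h1, h2⟩ := ih
    have hsub := rotheNat_mul_sw_subset (ev l) d
    have hfin := (h1.image fun b : ℕ × ℕ => (b.1, sw d b.2)).insert (ev l d, d)
    rw [ev_append, ev_singleton]
    refine ⟨hfin.subset hsub, (Set.ncard_le_ncard hsub hfin).trans ?_⟩
    refine (Set.ncard_insert_le _ _).trans ?_
    have := Set.ncard_image_le (f := fun b : ℕ × ℕ => (b.1, sw d b.2)) h1
    simp only [List.length_append, List.length_singleton]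
    omega

/-- The letters at the points of `C` with height `y` and abscissa less than `k`, in a rectangle
of height `n`. -/
def rowLetters (n : ℕ) (C : Finset (ℕ × ℕ)) (y k : ℕ) : List ℕ :=
  ((List.range k).filter fun x => (x, y) ∈ C).map fun x => x + (n - y)

/-- The letters at the points of `C` with height less than `k` in a rectangle of width `m` and
height `n`, row by row from bottom to top and each row from left to right. The points of `C`
are the crossings of a pipe dream, the other points are its elbows. -/
def letters (n m : ℕ) (C : Finset (ℕ × ℕ)) (k : ℕ) : List ℕ :=
  (List.range k).flatMap fun y => rowLetters n C y (m + 1)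

section Rows

variable {n m : ℕ} {C C' : Finset (ℕ × ℕ)} {y k x d i : ℕ}

theorem rowLetters_succ : rowLetters n C y (k + 1) =
    rowLetters n C y k ++ if (k, y) ∈ C then [k + (n - y)] else [] := by
  rw [rowLetters, List.range_succ, List.filter_append, List.map_append, rowLetters]
  by_cases h : (k, y) ∈ C <;> simp [h]

theorem letters_succ :
    letters n m C (k + 1) = letters n m C k ++ rowLetters n C k (m + 1) := by
  rw [letters, List.range_succ, List.flatMap_append, letters]
  simp

theorem rowLetters_congr (h : ∀ x < k, (x, y) ∈ C ↔ (x, y) ∈ C') :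
    rowLetters n C y k = rowLetters n C' y k := by
  rw [rowLetters, rowLetters]
  congr 1
  refine List.filter_congr fun x hx => ?_
  rw [List.mem_range] at hx
  simp [h x hx]

theorem letters_congr (h : ∀ x y, y < k → ((x, y) ∈ C ↔ (x, y) ∈ C')) :
    letters n m C k = letters n m C' k := by
  rw [letters, letters]
  refine List.flatMap_congr fun y hy => ?_
  rw [List.mem_range] at hy
  exact rowLetters_congr fun x _ => h x y hy

theorem ev_rowLetters_apply_of_forall
    (h : ∀ x < k, (x, y) ∈ C → i ≠ x + (n - y) ∧ i ≠ x + (n - y) + 1) :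
    ev (rowLetters n C y k) i = i := by
  induction k with
  | zero => rfl
  | succ k ih =>
    rw [rowLetters_succ, ev_append, Equiv.Perm.mul_apply]
    split_ifs with hk
    · rw [ev_singleton, sw_apply_of_ne (h k (Nat.lt_succ_self k) hk).1
        (h k (Nat.lt_succ_self k) hk).2]
      exact ih fun x hx => h x (by omega)
    · exact ih fun x hx => h x (by omega)

/-- A pipe that enters a crossing vertically leaves its row one index further. -/
theorem ev_rowLetters_apply_of_mem (hx : (x, y) ∈ C) (hk : x < k) :
    ev (rowLetters n C y k) (x + (n - y)) = x + (n - y) + 1 := by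
  induction k with
  | zero => omega
  | succ k ih =>
    rw [rowLetters_succ, ev_append, Equiv.Perm.mul_apply]
    rcases Nat.lt_succ_iff_lt_or_eq.1 hk with h | rfl
    · split_ifs
      · rw [ev_singleton, sw_apply_of_ne (by omega) (by omega)]
        exact ih h
      · exact ih h
    · rw [if_pos hx, ev_singleton, sw_apply_left]
      exact ev_rowLetters_apply_of_forall fun x' hx' _ => by omega

theorem ev_rowLetters_insert (h : ∀ x', x' ≠ x → ((x', y) ∈ C ↔ (x', y) ∈ C'))
    (hx : (x, y) ∉ C) (hx' : (x, y) ∈ C') (hx1 : (x + 1, y) ∉ C) (hk : x < k) :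
    ev (rowLetters n C' y k) = ev (rowLetters n C y k) * sw (x + (n - y)) := by
  induction k with
  | zero => omega
  | succ k ih =>
    rw [rowLetters_succ, ev_append, rowLetters_succ, ev_append]
    rcases Nat.lt_succ_iff_lt_or_eq.1 hk with h' | rfl
    · rw [ih h', mul_assoc, mul_assoc]
      congr 1
      by_cases hkC : (k, y) ∈ C
      · have hne : k ≠ x + 1 := by rintro rfl; exact hx1 hkC
        rw [if_pos hkC, if_pos ((h k (by omega)).1 hkC), ev_singleton]
        refine mul_sw _ ?_ ?_ |>.symm <;>
        exact sw_apply_of_ne (by omega) (by omega)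
      · rw [if_neg hkC, if_neg (fun e => hkC ((h k (by omega)).2 e))]
        simp
    · rw [if_neg hx, if_pos hx', rowLetters_congr fun a ha => h a ha.ne]
      simp

theorem ev_rowLetters_insert_left (h : ∀ x', x' ≠ x + 1 → ((x', y) ∈ C ↔ (x', y) ∈ C'))
    (hx : (x, y) ∉ C) (hx1 : (x + 1, y) ∉ C) (hx1' : (x + 1, y) ∈ C') (hk : x + 1 < k) :
    ev (rowLetters n C' y k) = sw (x + 1 + (n - y)) * ev (rowLetters n C y k) := by
  induction k with
  | zero => omega
  | succ k ih =>
    rw [rowLetters_succ, ev_append, rowLetters_succ, ev_append]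
    rcases Nat.lt_succ_iff_lt_or_eq.1 hk with h' | rfl
    · rw [ih h', mul_assoc]
      congr 3
      simp only [h k (by omega)]
    · rw [if_neg hx1, if_pos hx1', rowLetters_congr (C := C') (C' := C)
        fun a ha => (h a ha.ne).symm, ev_singleton, ev_nil, mul_one]
      have hf : ∀ a < x + 1, (a, y) ∈ C → a < x := by
        intro a ha haC
        rcases Nat.lt_succ_iff_lt_or_eq.1 ha with ha | rfl
        · exact ha
        · exact absurd haC hx
      refine mul_sw _ ?_ ?_ <;>
      · refine ev_rowLetters_apply_of_forall fun a ha haC => ?_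
        have := hf a ha haC
        omega

theorem ev_letters_succ :
    ev (letters n m C (k + 1)) = ev (letters n m C k) * ev (rowLetters n C k (m + 1)) := by
  rw [letters_succ, ev_append]

theorem ev_letters_congr_right {a : ℕ} (hk : a ≤ k)
    (h : ∀ x y, a ≤ y → ((x, y) ∈ C ↔ (x, y) ∈ C'))
    (he : ev (letters n m C a) = ev (letters n m C' a)) :
    ev (letters n m C k) = ev (letters n m C' k) := by
  induction k, hk using Nat.le_induction with
  | base => exact he
  | succ k hk ih =>
    rw [ev_letters_succ, ev_letters_succ, ih, rowLetters_congr fun x _ => h x k hk]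

/-- Small indices are fixed by the lower rows. -/
theorem ev_letters_apply_of_le (hk : k ≤ n) (hi : i ≤ n - k) :
    ev (letters n m C k) i = i := by
  induction k with
  | zero => rfl
  | succ k ih =>
    rw [ev_letters_succ, Equiv.Perm.mul_apply,
      ev_rowLetters_apply_of_forall (fun x _ _ => by omega)]
    exact ih (by omega) (by omega)

/-- Two adjacent pipes that run vertically through the rows below `k` of a pair of adjacent
columns. -/
theorem ev_letters_mul_sw (hx : x < m) (hk : k ≤ n + 1)
    (h : ∀ b < k, (x, b) ∈ C ∧ (x + 1, b) ∈ C) :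
    ev (letters n m C k) * sw (x + (n + 1 - k)) = sw (x + (n + 1)) * ev (letters n m C k) := by
  induction k with
  | zero => simp [letters]
  | succ k ih =>
    have hr := mul_sw (ev (rowLetters n C k (m + 1))) (d := x + (n - k)) (e := x + (n + 1 - k))
      (by rw [ev_rowLetters_apply_of_mem (h k (by omega)).1 (by omega)]; omega)
      (by
        have := ev_rowLetters_apply_of_mem (n := n) (h k (by omega)).2 (k := m + 1) (by omega)
        rw [show x + 1 + (n - k) = x + (n - k) + 1 by omega] at this
        rw [this]
        omega)
    rw [ev_letters_succ, Nat.add_sub_add_right, mul_assoc, hr, ← mul_assoc, ih (by omega)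
      (fun b hb => h b (by omega)), mul_assoc]

/-- A crossing that is added at the lower left corner of two adjacent columns can be moved up
through rows with two crossings. -/
theorem ev_letters_insert {a : ℕ} (hx : x < m) (hak : a < k) (hk : k ≤ n + 1)
    (hC : ∀ p, p ≠ (x, a) → (p ∈ C ↔ p ∈ C')) (h1 : (x, a) ∉ C) (h1' : (x, a) ∈ C')
    (h2 : (x + 1, a) ∉ C) (h : ∀ b, a < b → b < k → (x, b) ∈ C ∧ (x + 1, b) ∈ C) :
    ev (letters n m C' k) = ev (letters n m C k) * sw (x + (n + 1 - k)) := by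
  induction k, hak using Nat.le_induction with
  | base =>
    rw [ev_letters_succ, ev_letters_succ,
      ev_rowLetters_insert (C := C) (C' := C') (fun x' hx' => hC _ (by simpa using hx')) h1 h1' h2
        (by omega),
      letters_congr (C := C) (C' := C') fun b c hc => hC _ (by simp; omega), mul_assoc,
      show n + 1 - a.succ = n - a by omega]
  | succ k hak ih =>
    have hc := h k (by omega) (Nat.lt_succ_self k)
    have hr := mul_sw (ev (rowLetters n C k (m + 1))) (d := x + (n - k)) (e := x + (n + 1 - k))
      (by rw [ev_rowLetters_apply_of_mem hc.1 (by omega)]; omega)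
      (by
        have := ev_rowLetters_apply_of_mem (n := n) hc.2 (k := m + 1) (by omega)
        rw [show x + 1 + (n - k) = x + (n - k) + 1 by omega] at this
        rw [this]
        omega)
    rw [ev_letters_succ, ev_letters_succ, ih (by omega) (fun b h3 h4 => h b h3 (by omega)),
      ← rowLetters_congr (C := C) (C' := C') fun b _ => hC _ (by simp; omega), mul_assoc, mul_assoc,
      Nat.add_sub_add_right, hr]

end Rows

/-- The rows `a < b` in the adjacent columns `x` and `x + 1` of a pipe dream: none of the four
corners belongs to the set `D` of crossings, while both points of every row in between do. A ladder
move exchanges the crossings `insert (x, a) D` for the crossings `insert (x + 1, b) D`. -/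
structure Ladder (D : Finset (ℕ × ℕ)) (x a b : ℕ) : Prop where
  lt : a < b
  lower_left : (x, a) ∉ D
  lower_right : (x + 1, a) ∉ D
  upper_left : (x, b) ∉ D
  upper_right : (x + 1, b) ∉ D
  between : ∀ c, a < c → c < b → (x, c) ∈ D ∧ (x + 1, c) ∈ D

section Ladder

variable {n m : ℕ} {D : Finset (ℕ × ℕ)} {x a b : ℕ}

theorem ev_letters_succ_insert_upper (hx : x < m) (hb : b ≤ n) (hD : (x, b) ∉ D)
    (hD' : (x + 1, b) ∉ D) :
    ev (letters n m (insert (x + 1, b) D) (b + 1)) =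
      ev (letters n m D b) * (sw (x + (n + 1 - b)) * ev (rowLetters n D b (m + 1))) := by
  rw [ev_letters_succ, ev_rowLetters_insert_left (C := D) (x := x)
    (fun x' hx' => by simp [hx']) hD hD' (Finset.mem_insert_self _ _) (by omega),
    letters_congr (C := insert (x + 1, b) D) (C' := D) fun x' y hy => by
      rw [Finset.mem_insert, or_iff_right]
      simp only [Prod.mk.injEq, not_and]
      omega,
    show x + 1 + (n - b) = x + (n + 1 - b) by omega]

/-- A ladder move does not change the permutation. -/
theorem Ladder.ev_insert_eq (h : Ladder D x a b) (hx : x < m) (hb : b ≤ n) :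
    ev (letters n m (insert (x, a) D) (n + 1)) =
      ev (letters n m (insert (x + 1, b) D) (n + 1)) := by
  have hab := h.lt
  refine ev_letters_congr_right (a := b + 1) (by omega) (fun x' y hy => ?_) ?_
  · rw [Finset.mem_insert, Finset.mem_insert, or_iff_right, or_iff_right] <;>
    · simp only [Prod.mk.injEq, not_and]
      omega
  · rw [ev_letters_succ_insert_upper hx hb h.upper_left h.upper_right, ev_letters_succ,
      ev_letters_insert (C := D) hx hab (by omega)
        (fun p hp => by simp [hp]) h.lower_left (Finset.mem_insert_self _ _) h.lower_right
        h.between,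
      mul_assoc]
    congr 2
    rw [rowLetters_congr fun x' _ => ?_]
    rw [Finset.mem_insert, or_iff_right]
    simp only [Prod.mk.injEq, not_and]
    omega

/-- Two pipes that cross at both corners of a ladder cross twice. -/
theorem Ladder.ev_insert_insert_eq (h : Ladder D x a b) (hx : x < m) (hb : b ≤ n) :
    ev (letters n m (insert (x + 1, b) (insert (x, a) D)) (n + 1)) =
      ev (letters n m D (n + 1)) := by
  have hab := h.lt
  refine ev_letters_congr_right (a := b + 1) (by omega) (fun x' y hy => ?_) ?_
  · rw [Finset.mem_insert, Finset.mem_insert, or_iff_right, or_iff_right] <;>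
    · simp only [Prod.mk.injEq, not_and]
      omega
  · rw [ev_letters_succ_insert_upper hx hb (by simp [h.upper_left]; omega)
      (by simp [h.upper_right]), ev_letters_succ,
      ev_letters_insert (C := D) hx hab (by omega)
        (fun p hp => by simp [hp]) h.lower_left (Finset.mem_insert_self _ _) h.lower_right
        h.between,
      mul_assoc, ← mul_assoc (sw _), Equiv.swap_mul_self, one_mul]
    congr 2
    refine rowLetters_congr fun x' _ => ?_
    rw [Finset.mem_insert, or_iff_right]
    simp only [Prod.mk.injEq, not_and]
    omega

/-- Two pipes that cross at `(x + 1, b)` and run down vertically from there start in adjacent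
places, so that the crossing can be moved to the front of the word. -/
theorem ev_insert_upper_eq_sw_mul (hx : x < m) (hb : b ≤ n) (hD : (x, b) ∉ D)
    (hD' : (x + 1, b) ∉ D) (h : ∀ c < b, (x, c) ∈ D ∧ (x + 1, c) ∈ D) :
    ev (letters n m (insert (x + 1, b) D) (n + 1)) =
      sw (x + (n + 1)) * ev (letters n m D (n + 1)) := by
  have key : ∀ k, b + 1 ≤ k → ev (letters n m (insert (x + 1, b) D) k) =
      sw (x + (n + 1)) * ev (letters n m D k) := by
    intro k hk
    induction k, hk using Nat.le_induction with
    | base =>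
      rw [ev_letters_succ_insert_upper hx hb hD hD', ← mul_assoc,
        ev_letters_mul_sw hx (by omega) h, ev_letters_succ, mul_assoc]
    | succ k hk ih =>
      rw [ev_letters_succ, ev_letters_succ, ih, mul_assoc]
      congr 2
      refine congrArg ev (rowLetters_congr fun x' _ => ?_)
      rw [Finset.mem_insert, or_iff_right]
      simp only [Prod.mk.injEq, not_and]
      omega
  exact key _ (by omega)

end Ladder

/-! ### Pipe dreams whose crossings are pushed to the left -/

section LeftJustified

variable {n m : ℕ} {C C' : Finset (ℕ × ℕ)}

theorem ev_rowLetters_of_justified {y K k : ℕ} (hK : K ≤ k)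
    (h : ∀ x < k, (x, y) ∈ C ↔ x < K) (i : ℕ) :
    ev (rowLetters n C y k) i = if i < n - y then i else if i < n - y + K then i + 1 else
      if i = n - y + K then n - y else i := by
  induction k generalizing K i with
  | zero =>
    obtain rfl : K = 0 := by omega
    simp only [rowLetters, List.range_zero, List.filter_nil, List.map_nil, ev_nil,
      Equiv.Perm.one_apply, add_zero]
    split_ifs <;> omega
  | succ k ih =>
    rw [rowLetters_succ, ev_append, Equiv.Perm.mul_apply]
    rcases hK.eq_or_lt with rfl | hK
    · rw [if_pos ((h k (by omega)).2 (by omega)), ev_singleton,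
        ih (K := k) le_rfl fun x hx => by rw [h x (by omega)]; omega]
      simp only [sw, Equiv.swap_apply_def]
      split_ifs <;> omega
    · rw [if_neg (by rw [h k (by omega)]; omega), ev_nil, Equiv.Perm.one_apply,
        ih (K := K) (by omega) fun x hx => by rw [h x (by omega)]]

/-- The permutation of a pipe dream with left-justified rows determines the rows. -/
theorem justified_unique {k : ℕ} (hk : k ≤ n + 1) {K K' : ℕ → ℕ}
    (hK : ∀ y < k, K y ≤ m + 1) (hK' : ∀ y < k, K' y ≤ m + 1)
    (h : ∀ y < k, ∀ x < m + 1, (x, y) ∈ C ↔ x < K y)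
    (h' : ∀ y < k, ∀ x < m + 1, (x, y) ∈ C' ↔ x < K' y)
    (he : ev (letters n m C k) = ev (letters n m C' k)) : ∀ y < k, K y = K' y := by
  induction k with
  | zero => intro y hy; omega
  | succ k ih =>
    have e := ev_rowLetters_of_justified (n := n) (hK k (by omega)) (h k (by omega))
    have e' := ev_rowLetters_of_justified (n := n) (hK' k (by omega)) (h' k (by omega))
    have hKK : K k = K' k := by
      have h1 : ev (letters n m C (k + 1)) (n - k + K k) = n - k := by
        rw [ev_letters_succ, Equiv.Perm.mul_apply, e, if_neg (by omega), if_neg (by omega),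
          if_pos rfl, ev_letters_apply_of_le (by omega) le_rfl]
      have h2 : ev (letters n m C' (k + 1)) (n - k + K' k) = n - k := by
        rw [ev_letters_succ, Equiv.Perm.mul_apply, e', if_neg (by omega), if_neg (by omega),
          if_pos rfl, ev_letters_apply_of_le (by omega) le_rfl]
      rw [← he] at h2
      have := (ev (letters n m C (k + 1))).injective (h1.trans h2.symm)
      omega
    have hrow : ev (rowLetters n C k (m + 1)) = ev (rowLetters n C' k (m + 1)) := by
      ext i
      rw [e, e', hKK]
    rw [ev_letters_succ, ev_letters_succ, hrow] at he
    intro y hy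
    rcases Nat.lt_succ_iff_lt_or_eq.1 hy with hy | rfl
    · exact ih (by omega) (fun y hy => hK y (by omega)) (fun y hy => hK' y (by omega))
        (fun y hy => h y (by omega)) (fun y hy => h' y (by omega)) (mul_right_cancel he) y hy
    · exact hKK

end LeftJustified

theorem length_rowLetters (n : ℕ) (C : Finset (ℕ × ℕ)) (y k : ℕ) :
    (rowLetters n C y k).length = (C.filter fun p => p.2 = y ∧ p.1 < k).card := by
  rw [rowLetters, List.length_map]
  have : C.filter (fun p => p.2 = y ∧ p.1 < k) =
      (((List.range k).filter fun x => (x, y) ∈ C).toFinset).image fun x => (x, y) := by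
    ext ⟨a, b⟩
    simp only [Finset.mem_filter, Finset.mem_image, List.mem_toFinset, List.mem_filter,
      List.mem_range, decide_eq_true_eq, Prod.mk.injEq]
    constructor
    · rintro ⟨h1, rfl, h2⟩
      exact ⟨a, ⟨h2, h1⟩, rfl, rfl⟩
    · rintro ⟨x, ⟨h1, h2⟩, rfl, rfl⟩
      exact ⟨h2, rfl, h1⟩
  rw [this, Finset.card_image_of_injective _ (fun a b h => by simpa using h),
    List.toFinset_card_of_nodup (List.nodup_range.filter _)]

theorem length_letters (n m : ℕ) (C : Finset (ℕ × ℕ)) (k : ℕ) (hm : ∀ p ∈ C, p.1 ≤ m) :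
    (letters n m C k).length = (C.filter fun p => p.2 < k).card := by
  induction k with
  | zero => simp [letters]
  | succ k ih =>
    rw [letters_succ, List.length_append, ih, length_rowLetters, ← Finset.card_union_of_disjoint]
    · congr 1
      ext p
      simp only [Finset.mem_union, Finset.mem_filter]
      constructor
      · rintro (h | h) <;> exact ⟨h.1, by omega⟩
      · rintro ⟨h1, h2⟩
        have := hm p h1
        by_cases h : p.2 < k
        · exact Or.inl ⟨h1, h⟩
        · exact Or.inr ⟨h1, by omega, by omega⟩
    · rw [Finset.disjoint_filter]
      intro p _ h1 h2
      omega

/-- The lattice points of the smallest rectangle that contains `ν`. -/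
def rect (ν : LatticePath) : Finset (ℕ × ℕ) :=
  Finset.range (width ν + 1) ×ˢ Finset.range (height ν + 1)

theorem mem_rect {ν : LatticePath} {x y : ℕ} :
    (x, y) ∈ rect ν ↔ x ≤ width ν ∧ y ≤ height ν := by
  simp [rect]

theorem A_subset_rect (ν : LatticePath) : A ν ⊆ rect ν := Finset.filter_subset _ _

/-- The permutation of the natural numbers that is the product of the letters at the points
of `C`. -/
def perm (ν : LatticePath) (C : Finset (ℕ × ℕ)) : Equiv.Perm ℕ :=
  ev (letters (height ν) (width ν) C (height ν + 1))

theorem length_letters_of_subset {ν : LatticePath} {C : Finset (ℕ × ℕ)} (hC : C ⊆ rect ν) :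
    (letters (height ν) (width ν) C (height ν + 1)).length = C.card := by
  rw [length_letters]
  · congr 1
    refine Finset.filter_true_of_mem fun p hp => ?_
    have := mem_rect.1 (show (p.1, p.2) ∈ rect ν from hC hp)
    omega
  · intro p hp
    exact (mem_rect.1 (show (p.1, p.2) ∈ rect ν from hC hp)).1

/-- The points of `A ν` that are not the last one of their row and not in the top row: the lower
left corners of the cells of the Ferrers diagram above `ν`. -/
def corners (ν : LatticePath) : Finset (ℕ × ℕ) :=
  (A ν).filter fun p => p.2 < height ν ∧ p.1 < rowEnd ν p.2

theorem mem_corners {ν : LatticePath} {x y : ℕ} :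
    (x, y) ∈ corners ν ↔ y < height ν ∧ x < rowEnd ν y := by
  simp only [corners, Finset.mem_filter, mem_A]
  constructor
  · exact And.right
  · intro h
    exact ⟨⟨h.1.le, h.2.le⟩, h⟩

theorem corners_subset_rect (ν : LatticePath) : corners ν ⊆ rect ν :=
  (Finset.filter_subset _ _).trans (A_subset_rect ν)

theorem rothe_letters_corners (ν : LatticePath) {k : ℕ} (hk : k ≤ height ν) {i j : ℕ}
    (hij : i < j) :
    ev (letters (height ν) (width ν) (corners ν) k) j <
        ev (letters (height ν) (width ν) (corners ν) k) i ↔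
      ∃ y < k, ev (letters (height ν) (width ν) (corners ν) k) j = height ν - y ∧
        height ν + 1 - k ≤ i ∧ i < height ν + 1 - k + rowEnd ν y := by
  induction k generalizing i j with
  | zero => simp [letters]; omega
  | succ k ih =>
    set π := ev (letters (height ν) (width ν) (corners ν) k) with hπ
    have hfix : ∀ i ≤ height ν - k, π i = i := fun i hi => ev_letters_apply_of_le (by omega) hi
    have hK := rowEnd_le_width ν k
    have hρ := ev_rowLetters_of_justified (n := height ν) (C := corners ν) (y := k)
      (K := rowEnd ν k) (k := width ν + 1) (by omega)
      (fun x _ => by rw [mem_corners]; constructor <;> intro h <;> omega)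
    set ρ := ev (rowLetters (height ν) (corners ν) k (width ν + 1)) with hρ'
    have hmul : ∀ i, ev (letters (height ν) (width ν) (corners ν) (k + 1)) i = π (ρ i) := by
      intro i
      rw [ev_letters_succ, Equiv.Perm.mul_apply]
    simp only [hmul]
    set d := height ν - k with hd
    have hR : ∀ y < k, rowEnd ν y ≤ rowEnd ν k := fun y hy => rowEnd_mono ν hy.le
    have hbig : ∀ i, d < i → d < π i := by
      intro i hi
      by_contra! hcon
      have := hfix _ hcon
      have := π.injective this
      omega
    have hi := hρ i
    have hj := hρ j
    have e1 : height ν + 1 - (k + 1) = d := by omega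
    have e2 : height ν + 1 - k = d + 1 := by omega
    rw [e1]
    have ih' : ∀ {i j : ℕ}, i < j → (π j < π i ↔ ∃ y < k, π j = height ν - y ∧ d + 1 ≤ i ∧
        i < d + 1 + rowEnd ν y) := by
      intro i j h
      rw [ih (by omega) h, e2]
    clear_value π ρ d
    by_cases hlt : ρ i < ρ j
    · rw [ih' hlt]
      constructor
      · rintro ⟨y, hy, h1, h2, h3⟩
        refine ⟨y, by omega, h1, ?_⟩
        have := hR y hy
        split_ifs at hi <;> omega
      · rintro ⟨y, hy, h1, h2, h3⟩
        have hyk : y < k := by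
          rcases Nat.lt_succ_iff_lt_or_eq.1 hy with h | rfl
          · exact h
          · exfalso
            rw [← hd] at h1
            have h4 : ρ j ≤ d := by
              by_contra! h4
              have := hbig _ h4
              omega
            split_ifs at hi hj <;> omega
        refine ⟨y, hyk, h1, ?_⟩
        have := hR y hyk
        split_ifs at hi <;> omega
    · have hjd : ρ j = d ∧ d ≤ i ∧ i < d + rowEnd ν k := by
        split_ifs at hi hj <;> omega
      rw [hjd.1, hfix d le_rfl]
      constructor
      · intro _
        exact ⟨k, Nat.lt_succ_self k, hd, hjd.2⟩
      · intro _
        apply hbig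
        split_ifs at hi <;> omega

theorem le_of_letters_corners (ν : LatticePath) {k : ℕ} (hk : k ≤ height ν) {j y : ℕ}
    (hy : y < k) (h : ev (letters (height ν) (width ν) (corners ν) k) j = height ν - y) :
    height ν + 1 - k + rowEnd ν y ≤ j := by
  induction k generalizing j with
  | zero => omega
  | succ k ih =>
    have hK := rowEnd_le_width ν k
    have hρ := ev_rowLetters_of_justified (n := height ν) (C := corners ν) (y := k)
      (K := rowEnd ν k) (k := width ν + 1) (by omega)
      (fun x _ => by rw [mem_corners]; constructor <;> intro h <;> omega) j
    rw [ev_letters_succ, Equiv.Perm.mul_apply] at h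
    rcases Nat.lt_succ_iff_lt_or_eq.1 hy with hy | rfl
    · have := ih (by omega) hy h
      split_ifs at hρ <;> omega
    · have hfix := ev_letters_apply_of_le (n := height ν) (m := width ν) (C := corners ν)
        (show y ≤ height ν by omega) (le_refl (height ν - y))
      have := (ev (letters (height ν) (width ν) (corners ν) y)).injective (h.trans hfix.symm)
      split_ifs at hρ <;> omega

theorem perm_corners_eq (ν : LatticePath) :
    perm ν (corners ν) = ev (letters (height ν) (width ν) (corners ν) (height ν)) := by
  rw [perm, ev_letters_succ]
  have : rowLetters (height ν) (corners ν) (height ν) (width ν + 1) = [] := by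
    rw [rowLetters, List.map_eq_nil_iff, List.filter_eq_nil_iff]
    intro x _
    simp [mem_corners]
  rw [this, ev_nil, mul_one]

/-- The Rothe diagram of the product of the letters at the lower left corners of the cells above
`ν` is the diagram of these cells. -/
theorem mem_rotheNat_perm_corners {ν : LatticePath} {v i : ℕ} :
    (v, i) ∈ rotheNat (perm ν (corners ν)) ↔
      ∃ y < height ν, v = height ν - y ∧ 1 ≤ i ∧ i < 1 + rowEnd ν y := by
  have key := fun {i j : ℕ} => rothe_letters_corners ν le_rfl (i := i) (j := j)
  rw [← perm_corners_eq, Nat.add_sub_cancel_left] at key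
  constructor
  · rintro ⟨a, j, h1, h2, h3⟩
    obtain ⟨rfl, rfl⟩ := Prod.mk.inj h3
    exact (key h1).1 h2
  · rintro ⟨y, hy, rfl, h1, h2⟩
    obtain ⟨j, hj⟩ := (perm ν (corners ν)).surjective (height ν - y)
    have hle := le_of_letters_corners ν le_rfl hy (by rw [← perm_corners_eq, hj])
    have hij : i < j := by omega
    exact ⟨i, j, hij, (key hij).2 ⟨y, hy, hj, h1, h2⟩, by rw [hj]⟩

theorem card_corners_le_ncard (ν : LatticePath) {S : Set (ℕ × ℕ)} (hS : S.Finite)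
    (h : rotheNat (perm ν (corners ν)) ⊆ S) : (corners ν).card ≤ S.ncard := by
  have hinj : Set.InjOn (fun p : ℕ × ℕ => (height ν - p.2, p.1 + 1)) (corners ν) := by
    rintro ⟨x, y⟩ h1 ⟨x', y'⟩ h2 h3
    have h1 := mem_corners.1 (Finset.mem_coe.1 h1)
    have h2 := mem_corners.1 (Finset.mem_coe.1 h2)
    simp only [Prod.mk.injEq] at h3 ⊢
    omega
  rw [← Set.ncard_coe_finset, ← hinj.ncard_image]
  refine Set.ncard_le_ncard ?_ hS
  rintro _ ⟨⟨x, y⟩, hp, rfl⟩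
  have hp := mem_corners.1 (Finset.mem_coe.1 hp)
  exact h (mem_rotheNat_perm_corners.2 ⟨y, hp.1, rfl, by omega, by omega⟩)

/-- The word of the corners is reduced. -/
theorem card_corners_le {ν : LatticePath} {l : List ℕ} (h : ev l = perm ν (corners ν)) :
    (corners ν).card ≤ l.length := by
  have := rotheNat_ev l
  rw [h] at this
  exact (card_corners_le_ncard ν this.1 subset_rfl).trans this.2

/-- Exchanging two values that are larger than all rows of the Ferrers diagram adds an
inversion. -/
theorem card_corners_le_of_sw_mul {ν : LatticePath} {l : List ℕ} {e : ℕ} (he : height ν < e)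
    (h : sw e * ev l = perm ν (corners ν)) : (corners ν).card ≤ l.length := by
  have hl := rotheNat_ev l
  refine (card_corners_le_ncard ν hl.1 ?_).trans hl.2
  rintro ⟨v, i⟩ hvi
  obtain ⟨y, hy, hv, -⟩ := mem_rotheNat_perm_corners.1 hvi
  obtain ⟨a, j, h1, h2, h3⟩ := hvi
  obtain ⟨h4, rfl⟩ := Prod.mk.inj h3
  have hlπ : ∀ z, ev l z = sw e (perm ν (corners ν) z) := by
    intro z
    rw [← h, Equiv.Perm.mul_apply, Equiv.swap_apply_self]
  have hj : ev l j = v := by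
    rw [hlπ, ← h4, sw_apply_of_ne (by omega) (by omega)]
  refine ⟨i, j, h1, ?_, by rw [hj]⟩
  rw [hj, hlπ]
  simp only [sw, Equiv.swap_apply_def]
  split_ifs <;> omega

/-! ### Ladder moves of `ν`-trees -/

/-- The set `C` is the complement of a `ν`-tree in `A ν`. -/
def IsTreeCompl (ν : LatticePath) (C : Finset (ℕ × ℕ)) : Prop :=
  C ⊆ A ν ∧ IsNuTree ν (A ν \ C)

theorem isTreeCompl_corners (ν : LatticePath) : IsTreeCompl ν (corners ν) := by
  refine ⟨Finset.filter_subset _ _, isNuTree_iff.2 ⟨Finset.sdiff_subset, ?_, ?_⟩⟩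
  · rintro ⟨a, b⟩ hp ⟨c, d⟩ hq ⟨h1, h2, h3⟩
    simp only at h1 h2 h3
    rw [Finset.mem_sdiff, mem_corners] at hp hq
    have := mem_A.1 hq.1
    exact hp.2 ⟨by omega, by omega⟩
  · rintro ⟨a, b⟩ hr hrT
    have hc : (a, b) ∈ corners ν := by
      by_contra hc
      exact hrT (Finset.mem_sdiff.2 ⟨hr, hc⟩)
    rw [mem_corners] at hc
    refine ⟨(rowEnd ν b, height ν), Finset.mem_sdiff.2 ⟨mem_A.2 ⟨le_rfl, ?_⟩, ?_⟩,
      Or.inl ⟨hc.2, hc.1, le_rfl⟩⟩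
    · exact rowEnd_mono ν hc.1.le
    · simp [mem_corners]

/-- A `ν`-tree whose complement is left-justified is the one whose complement consists of the
corners. -/
theorem IsTreeCompl.eq_corners {ν : LatticePath} {C : Finset (ℕ × ℕ)} (h : IsTreeCompl ν C)
    (hC : ∀ x y, (x + 1, y) ∈ C → (x, y) ∈ C) : C = corners ν := by
  obtain ⟨hCA, hT⟩ := h
  obtain ⟨h1, h2, h3⟩ := isNuTree_iff.1 hT
  have h0 : (0, height ν) ∉ C :=
    (Finset.mem_sdiff.1 (hT.flush.top 0 (Nat.zero_le _) (live_zero _ _))).2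
  have htop : ∀ x, (x, height ν) ∉ C := by
    intro x
    induction x with
    | zero => exact h0
    | succ x ih => exact fun h => ih (hC _ _ h)
  have hsub : corners ν ⊆ C := by
    rintro ⟨x, y⟩ hp
    have hp' := mem_corners.1 hp
    by_contra hpC
    exact h2 (x, y) (Finset.mem_sdiff.2 ⟨Finset.filter_subset _ _ hp, hpC⟩) (rowEnd ν y, height ν)
      (Finset.mem_sdiff.2 ⟨mem_A.2 ⟨le_rfl, rowEnd_mono ν hp'.1.le⟩, htop _⟩)
      ⟨hp'.2, hp'.1, le_rfl⟩
  refine Finset.Subset.antisymm ?_ hsub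
  rintro ⟨x, y⟩ hp
  have hpA := mem_A.1 (hCA hp)
  have hyn : y < height ν := by
    refine lt_of_le_of_ne hpA.1 ?_
    rintro rfl
    exact htop x hp
  rw [mem_corners]
  refine ⟨hyn, lt_of_le_of_ne hpA.2 ?_⟩
  rintro rfl
  obtain ⟨⟨a, b⟩, ht, ⟨e1, e2, e3⟩ | ⟨e1, e2, e3⟩⟩ := h3 _ (hCA hp)
    (fun h => (Finset.mem_sdiff.1 h).2 hp)
  · simp only at e1 e3
    omega
  · simp only at e1 e2 e3
    exact (Finset.mem_sdiff.1 ht).2 (hsub (mem_corners.2 ⟨by omega, by omega⟩))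

/-- A ladder move turns complements of `ν`-trees into complements of `ν`-trees. -/
theorem Ladder.isTreeCompl_upper {ν : LatticePath} {D : Finset (ℕ × ℕ)} {x a b : ℕ}
    (h : Ladder D x a b) (hb : b ≤ height ν) (hT : IsTreeCompl ν (insert (x, a) D)) :
    IsTreeCompl ν (insert (x + 1, b) D) := by
  obtain ⟨hCA, hT⟩ := hT
  obtain ⟨-, h2, h3⟩ := isNuTree_iff.1 hT
  have hab := h.lt
  have hmono : ∀ {c d : ℕ}, c ≤ d → rowEnd ν c ≤ rowEnd ν d := fun h => rowEnd_mono ν h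
  have hmem : ∀ {p}, p ∈ A ν \ insert (x, a) D ↔ p ∈ A ν ∧ p ≠ (x, a) ∧ p ∉ D := by
    intro p
    simp [not_or]
  have hmem' : ∀ {p}, p ∈ A ν \ insert (x + 1, b) D ↔ p ∈ A ν ∧ p ≠ (x + 1, b) ∧ p ∉ D := by
    intro p
    simp [not_or]
  have hpA := hCA (Finset.mem_insert_self _ _)
  have hp := mem_A.1 hpA
  have hul : (x, b) ∈ A ν \ insert (x, a) D :=
    hmem.2 ⟨mem_A.2 ⟨hb, hp.2.trans (hmono hab.le)⟩, by simp; omega, h.upper_left⟩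
  have hR : x + 1 ≤ rowEnd ν a := by
    by_contra! hR
    obtain ⟨⟨c, d⟩, ht, ⟨e1, e2, e3⟩ | ⟨e1, e2, e3⟩⟩ := h3 _ hpA (fun e => (hmem.1 e).2.1 rfl)
    · simp only at e1 e2 e3
      omega
    · exact h2 _ ht _ hul ⟨e1, e2.trans hab, e3⟩
  have hlr : (x + 1, a) ∈ A ν \ insert (x, a) D :=
    hmem.2 ⟨mem_A.2 ⟨hp.1, hR⟩, by simp, h.lower_right⟩
  have hur : (x + 1, b) ∈ A ν \ insert (x, a) D :=
    hmem.2 ⟨mem_A.2 ⟨hb, hR.trans (hmono hab.le)⟩, by simp, h.upper_right⟩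
  have hnew : ∀ t ∈ A ν \ insert (x, a) D, t ≠ (x + 1, b) →
      ¬ SW ν t (x, a) ∧ ¬ SW ν (x, a) t := by
    rintro ⟨c, d⟩ ht hne
    refine ⟨?_, ?_⟩
    · rintro ⟨e1, e2, e3⟩
      exact h2 _ ht _ hul ⟨e1, e2.trans hab, e3⟩
    · rintro ⟨e1, e2, e3⟩
      simp only at e1 e2 e3
      rcases Nat.lt_or_ge (x + 1) c with hc | hc
      · exact h2 _ hlr _ ht ⟨hc, e2, e3⟩
      · obtain rfl : c = x + 1 := by omega
        rcases lt_trichotomy d b with hd | rfl | hd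
        · exact (hmem.1 ht).2.2 (h.between d e2 hd).2
        · exact hne rfl
        · exact h2 _ hul _ ht ⟨e1, hd, by have := hmono hab.le; simp only; omega⟩
  have hrr : ∀ r, ¬ SW ν r r := fun r h => lt_irrefl _ h.1
  have hor : ∀ {p}, p ∈ A ν \ insert (x + 1, b) D → p = (x, a) ∨
      p ∈ A ν \ insert (x, a) D ∧ p ≠ (x + 1, b) := by
    intro p hp
    rw [hmem'] at hp
    rw [hmem]
    tauto
  have hor' : ∀ {p}, p ∈ A ν \ insert (x, a) D → p ≠ (x + 1, b) →
      p ∈ A ν \ insert (x + 1, b) D := by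
    intro p hp
    rw [hmem] at hp
    rw [hmem']
    tauto
  have hp' : (x, a) ∈ A ν \ insert (x + 1, b) D := hmem'.2 ⟨hpA, by simp, h.lower_left⟩
  refine ⟨?_, isNuTree_iff.2 ⟨Finset.sdiff_subset, ?_, ?_⟩⟩
  · rw [Finset.insert_subset_iff]
    exact ⟨(hmem.1 hur).1, (Finset.subset_insert _ _).trans hCA⟩
  · intro p hp q hq
    rcases hor hp with rfl | hp'' <;> rcases hor hq with rfl | hq''
    · exact hrr _
    · exact (hnew q hq''.1 hq''.2).2
    · exact (hnew p hp''.1 hp''.2).1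
    · exact h2 p hp''.1 q hq''.1
  · intro r hr hrT
    by_cases hrq : r = (x + 1, b)
    · exact ⟨_, hp', Or.inr (hrq ▸ ⟨Nat.lt_succ_self x, hab, hR⟩)⟩
    have hrT' : r ∉ A ν \ insert (x, a) D := fun e => hrT (hor' e hrq)
    obtain ⟨t, ht, htr⟩ := h3 r hr hrT'
    by_cases htq : t = (x + 1, b)
    · subst htq
      obtain ⟨c, d⟩ := r
      rcases htr with ⟨e1, e2, e3⟩ | ⟨e1, e2, e3⟩
      · simp only at e1 e2 e3
        rcases Nat.lt_succ_iff_lt_or_eq.1 e1 with hc | rfl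
        · exact ⟨_, hor' hul (by simp), Or.inl ⟨hc, e2, by simp only; omega⟩⟩
        · rcases lt_trichotomy d a with hd | rfl | hd
          · exact ⟨_, hor' hlr (by simp; omega), Or.inl ⟨Nat.lt_succ_self c, hd, e3⟩⟩
          · exact absurd hp' hrT
          · -- The point `(c + 1, d)` is not in the tree either, hence incompatible with a point
            -- of it, which is incompatible with `(c, d)`, too.
            obtain ⟨⟨c', d'⟩, ht', ⟨f1, f2, f3⟩ | ⟨f1, f2, f3⟩⟩ := h3 (c + 1, d)
              (mem_A.2 ⟨by omega, e3⟩)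
              (fun e => (hmem.1 e).2.2 (h.between d hd e2).2)
            · simp only at f1 f2 f3
              exact ⟨_, hor' ht' (by simp; omega), Or.inl ⟨by simp only; omega, f2, f3⟩⟩
            · exact absurd ⟨f1, f2.trans e2, f3⟩ (h2 _ ht' _ hur)
      · simp only at e1 e2 e3
        exact ⟨_, hor' hul (by simp), Or.inr ⟨by simp only; omega, e2, e3⟩⟩
    · exact ⟨t, hor' ht htq, htr⟩

/-- An inverse ladder move turns complements of `ν`-trees into complements of `ν`-trees. -/
theorem Ladder.isTreeCompl_lower {ν : LatticePath} {D : Finset (ℕ × ℕ)} {x a b : ℕ}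
    (h : Ladder D x a b) (hR : x + 1 ≤ rowEnd ν a) (hT : IsTreeCompl ν (insert (x + 1, b) D)) :
    IsTreeCompl ν (insert (x, a) D) := by
  obtain ⟨hCA, hT⟩ := hT
  obtain ⟨-, h2, h3⟩ := isNuTree_iff.1 hT
  have hab := h.lt
  have hmono : ∀ {c d : ℕ}, c ≤ d → rowEnd ν c ≤ rowEnd ν d := fun h => rowEnd_mono ν h
  have hmem : ∀ {p}, p ∈ A ν \ insert (x, a) D ↔ p ∈ A ν ∧ p ≠ (x, a) ∧ p ∉ D := by
    intro p
    simp [not_or]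
  have hmem' : ∀ {p}, p ∈ A ν \ insert (x + 1, b) D ↔ p ∈ A ν ∧ p ≠ (x + 1, b) ∧ p ∉ D := by
    intro p
    simp [not_or]
  have hqA := hCA (Finset.mem_insert_self _ _)
  have hb := (mem_A.1 hqA).1
  have hR' := hR.trans (hmono hab.le)
  have hul : (x, b) ∈ A ν \ insert (x + 1, b) D :=
    hmem'.2 ⟨mem_A.2 ⟨hb, by omega⟩, by simp, h.upper_left⟩
  have hlr : (x + 1, a) ∈ A ν \ insert (x + 1, b) D :=
    hmem'.2 ⟨mem_A.2 ⟨by omega, hR⟩, by simp; omega, h.lower_right⟩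
  have hll : (x, a) ∈ A ν \ insert (x + 1, b) D :=
    hmem'.2 ⟨mem_A.2 ⟨by omega, by omega⟩, by simp, h.lower_left⟩
  have hnew : ∀ t ∈ A ν \ insert (x + 1, b) D, t ≠ (x, a) →
      ¬ SW ν t (x + 1, b) ∧ ¬ SW ν (x + 1, b) t := by
    rintro ⟨c, d⟩ ht hne
    refine ⟨?_, ?_⟩
    · rintro ⟨e1, e2, e3⟩
      simp only at e1 e2 e3
      rcases Nat.lt_succ_iff_lt_or_eq.1 e1 with hc | rfl
      · exact h2 _ ht _ hul ⟨hc, e2, by simp only; omega⟩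
      · rcases lt_trichotomy d a with hd | rfl | hd
        · exact h2 _ ht _ hlr ⟨e1, hd, e3⟩
        · exact hne rfl
        · exact (hmem'.1 ht).2.2 (h.between d hd e2).1
    · rintro ⟨e1, e2, e3⟩
      simp only at e1 e2 e3
      exact h2 _ hul _ ht ⟨by simp only; omega, e2, e3⟩
  have hrr : ∀ r, ¬ SW ν r r := fun r h => lt_irrefl _ h.1
  have hor : ∀ {p}, p ∈ A ν \ insert (x, a) D → p = (x + 1, b) ∨
      p ∈ A ν \ insert (x + 1, b) D ∧ p ≠ (x, a) := by
    intro p hp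
    rw [hmem] at hp
    rw [hmem']
    tauto
  have hor' : ∀ {p}, p ∈ A ν \ insert (x + 1, b) D → p ≠ (x, a) →
      p ∈ A ν \ insert (x, a) D := by
    intro p hp
    rw [hmem'] at hp
    rw [hmem]
    tauto
  have hq' : (x + 1, b) ∈ A ν \ insert (x, a) D := hmem.2 ⟨hqA, by simp, h.upper_right⟩
  refine ⟨?_, isNuTree_iff.2 ⟨Finset.sdiff_subset, ?_, ?_⟩⟩
  · rw [Finset.insert_subset_iff]
    exact ⟨(hmem'.1 hll).1, (Finset.subset_insert _ _).trans hCA⟩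
  · intro p hp q hq
    rcases hor hp with rfl | hp'' <;> rcases hor hq with rfl | hq''
    · exact hrr _
    · exact (hnew q hq''.1 hq''.2).2
    · exact (hnew p hp''.1 hp''.2).1
    · exact h2 p hp''.1 q hq''.1
  · intro r hr hrT
    by_cases hrp : r = (x, a)
    · exact ⟨_, hq', Or.inl (hrp ▸ ⟨Nat.lt_succ_self x, hab, hR⟩)⟩
    have hrT' : r ∉ A ν \ insert (x + 1, b) D := fun e => hrT (hor' e hrp)
    obtain ⟨t, ht, htr⟩ := h3 r hr hrT'
    by_cases htp : t = (x, a)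
    · subst htp
      obtain ⟨c, d⟩ := r
      rcases htr with ⟨e1, e2, e3⟩ | ⟨e1, e2, e3⟩
      · exact ⟨_, hor' hul (by simp; omega), Or.inl ⟨e1, e2.trans hab, e3⟩⟩
      · simp only at e1 e2 e3
        rcases Nat.lt_or_ge (x + 1) c with hc | hc
        · exact ⟨_, hor' hlr (by simp), Or.inr ⟨hc, e2, e3⟩⟩
        · obtain rfl : c = x + 1 := by omega
          rcases lt_trichotomy d b with hd | rfl | hd
          · -- The point `(x, d)` is not in the tree either, hence incompatible with a point
            -- of it, which is incompatible with `(x + 1, d)`, too.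
            obtain ⟨⟨c', d'⟩, ht', ⟨f1, f2, f3⟩ | ⟨f1, f2, f3⟩⟩ := h3 (x, d)
              (mem_A.2 ⟨by omega, by have := hmono e2.le; omega⟩)
              (fun e => (hmem'.1 e).2.2 (h.between d e2 hd).1)
            · simp only at f1 f2 f3
              have hc' : c' ≠ x + 1 := by
                rintro rfl
                exact h2 _ hll _ ht' ⟨f1, e2.trans f2, by simpa using hR⟩
              exact ⟨_, hor' ht' (by simp; omega), Or.inl ⟨by simp only; omega, f2, f3⟩⟩
            · exact absurd ⟨f1, f2.trans hd, f3⟩ (h2 _ ht' _ hul)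
          · exact absurd hq' hrT
          · exact ⟨_, hor' hul (by simp; omega), Or.inr ⟨e1, hd, by simp only; omega⟩⟩
    · exact ⟨t, hor' ht htp, htr⟩

/-! ### Pipe dreams and `ν`-trees -/

/-- The lowest row that is not left-justified. -/
theorem exists_lowest_gap {C : Finset (ℕ × ℕ)} (h : ¬ ∀ x y, (x + 1, y) ∈ C → (x, y) ∈ C) :
    ∃ x b, (x, b) ∉ C ∧ (x + 1, b) ∈ C ∧ ∀ y < b, ∀ x, (x + 1, y) ∈ C → (x, y) ∈ C := by
  classical
  push Not at h
  obtain ⟨x, y, h1, h2⟩ := h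
  have hex : ∃ y x, (x + 1, y) ∈ C ∧ (x, y) ∉ C := ⟨y, x, h1, h2⟩
  obtain ⟨x, hx1, hx2⟩ := Nat.find_spec hex
  refine ⟨x, Nat.find hex, hx2, hx1, fun y hy x hx => ?_⟩
  have := Nat.find_min hex hy
  push Not at this
  exact this x hx

theorem sum_lower_lt {D : Finset (ℕ × ℕ)} {x a b : ℕ} (h : Ladder D x a b) :
    ∑ p ∈ insert (x, a) D, p.1 < ∑ p ∈ insert (x + 1, b) D, p.1 := by
  rw [Finset.sum_insert h.lower_left, Finset.sum_insert h.upper_right]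
  simp

/-- The set `C` is a reduced pipe dream of the permutation of `ν`. -/
structure IsDream (ν : LatticePath) (C : Finset (ℕ × ℕ)) : Prop where
  subset : C ⊆ rect ν
  perm_eq : perm ν C = perm ν (corners ν)
  card_eq : C.card = (corners ν).card

theorem IsDream.eq_corners {ν : LatticePath} {C : Finset (ℕ × ℕ)} (h : IsDream ν C)
    (hC : ∀ x y, (x + 1, y) ∈ C → (x, y) ∈ C) : C = corners ν := by
  have hanti : ∀ y x d, (x + d, y) ∈ C → (x, y) ∈ C := by
    intro y x d
    induction d with
    | zero => exact id
    | succ d ih => exact fun h => ih (hC _ _ h)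
  have hout : ∀ y, ∃ x, (x, y) ∉ C := fun y => ⟨width ν + 1, fun h' => by
    have := (mem_rect.1 (h.subset h')).1
    omega⟩
  classical
  have hK : ∀ x y, (x, y) ∈ C ↔ x < Nat.find (hout y) := by
    intro x y
    constructor
    · intro hx
      by_contra! hcon
      refine Nat.find_spec (hout y) (hanti y _ (x - Nat.find (hout y)) ?_)
      rwa [Nat.add_sub_cancel' hcon]
    · exact fun hx => not_not.1 (Nat.find_min (hout y) hx)
  have hKm : ∀ y, Nat.find (hout y) ≤ width ν + 1 := fun y =>
    Nat.find_min' _ fun h' => by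
      have := (mem_rect.1 (h.subset h')).1
      omega
  have key := justified_unique (n := height ν) (m := width ν) (C := C) (C' := corners ν) le_rfl
    (K := fun y => Nat.find (hout y)) (K' := fun y => if y < height ν then rowEnd ν y else 0)
    (fun y _ => hKm y)
    (fun y _ => by have := rowEnd_le_width ν y; split_ifs <;> omega)
    (fun y _ x _ => hK x y)
    (fun y _ x _ => by rw [mem_corners]; split_ifs <;> omega) h.perm_eq
  ext ⟨x, y⟩
  rw [hK, mem_corners]
  by_cases hy : y < height ν + 1
  · have := key y hy
    rw [this]
    split_ifs <;> omega
  · have : ¬ x < Nat.find (hout y) := by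
      rw [← hK]
      intro h'
      have := (mem_rect.1 (h.subset h')).2
      omega
    omega

/-- A reduced pipe dream with a row that is not left-justified admits an inverse ladder move: take
the lowest such row, a crossing of it with an elbow to its left, and go down in the two columns
past the rows with two crossings. Otherwise two pipes would cross twice, or
two pipes that start in order at the bottom would cross. -/
theorem IsDream.exists_ladder {ν : LatticePath} {C : Finset (ℕ × ℕ)} (h : IsDream ν C)
    (hC : ¬ ∀ x y, (x + 1, y) ∈ C → (x, y) ∈ C) :
    ∃ D x a b, Ladder D x a b ∧ C = insert (x + 1, b) D ∧ IsDream ν (insert (x, a) D) := by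
  obtain ⟨x, b, h1, h2, h3⟩ := exists_lowest_gap hC
  have hrect := mem_rect.1 (h.subset h2)
  have hins := Finset.insert_erase h2
  have hcard := Finset.card_erase_add_one h2
  by_cases hall : ∀ c < b, (x, c) ∈ C ∧ (x + 1, c) ∈ C
  · exfalso
    have e1 := ev_insert_upper_eq_sw_mul (n := height ν) (m := width ν) (D := C.erase (x + 1, b))
      (x := x) (b := b) (by omega) hrect.2 (by simp [h1]) (by simp)
      (fun c hc => by
        have := hall c hc
        simp only [Finset.mem_erase]
        exact ⟨⟨by simp, this.1⟩, by simp; omega, this.2⟩)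
    rw [hins] at e1
    have e2 := card_corners_le_of_sw_mul (ν := ν) (by omega) (e1.symm.trans h.perm_eq)
    rw [length_letters_of_subset ((Finset.erase_subset _ _).trans h.subset)] at e2
    have := h.card_eq
    omega
  · obtain ⟨a, hab, hna, hbet⟩ : ∃ a < b, ¬ ((x, a) ∈ C ∧ (x + 1, a) ∈ C) ∧
        ∀ c, a < c → c < b → (x, c) ∈ C ∧ (x + 1, c) ∈ C := by
      classical
      have hP : ∃ c, c < b ∧ ¬ ((x, c) ∈ C ∧ (x + 1, c) ∈ C) := by
        push Not at hall ⊢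
        exact hall
      let P := fun c => c < b ∧ ¬ ((x, c) ∈ C ∧ (x + 1, c) ∈ C)
      obtain ⟨c, hc⟩ := hP
      have hspec : P (Nat.findGreatest P b) := Nat.findGreatest_spec (m := c) hc.1.le hc
      refine ⟨Nat.findGreatest P b, hspec.1, hspec.2, fun d hd hdb => ?_⟩
      by_contra hcon
      exact Nat.findGreatest_is_greatest hd hdb.le ⟨hdb, hcon⟩
    have hlr : (x + 1, a) ∉ C := fun hlr => hna ⟨h3 a hab x hlr, hlr⟩
    have hL : Ladder ((C.erase (x + 1, b)).erase (x, a)) x a b := by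
      refine ⟨hab, by simp, by simp [hlr], by simp [h1], by simp, fun c hc hcb => ?_⟩
      have := hbet c hc hcb
      simp only [Finset.mem_erase, ne_eq, Prod.mk.injEq, this.1, this.2, and_true]
      omega
    by_cases hla : (x, a) ∈ C
    · exfalso
      have hla' : (x, a) ∈ C.erase (x + 1, b) := by simp [hla]
      have e1 := hL.ev_insert_insert_eq (n := height ν) (m := width ν) (by omega) hrect.2
      rw [Finset.insert_erase hla', hins] at e1
      have e2 := card_corners_le (ν := ν) (e1.symm.trans h.perm_eq)
      rw [length_letters_of_subset (((Finset.erase_subset _ _).trans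
        (Finset.erase_subset _ _)).trans h.subset)] at e2
      have := Finset.card_erase_add_one hla'
      have := h.card_eq
      omega
    · have hD : (C.erase (x + 1, b)).erase (x, a) = C.erase (x + 1, b) :=
        Finset.erase_eq_of_notMem (by simp [hla])
      rw [hD] at hL
      refine ⟨_, x, a, b, hL, hins.symm, ⟨?_, ?_, ?_⟩⟩
      · rw [Finset.insert_subset_iff]
        exact ⟨mem_rect.2 ⟨by omega, by omega⟩, (Finset.erase_subset _ _).trans h.subset⟩
      · rw [perm, hL.ev_insert_eq (by omega) hrect.2, hins]
        exact h.perm_eq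
      · rw [Finset.card_insert_of_notMem hL.lower_left, hcard, h.card_eq]

/-- If a `ν`-tree has a row in which a point of the complement follows a point of the tree, then the
inverse ladder move exists in the lowest such row: the point of the complement is incompatible
with a point of the tree, which lies in the column to its left, as it is compatible with the tree
point to the left. -/
theorem IsTreeCompl.exists_ladder {ν : LatticePath} {C : Finset (ℕ × ℕ)} (h : IsTreeCompl ν C)
    (hC : ¬ ∀ x y, (x + 1, y) ∈ C → (x, y) ∈ C) :
    ∃ D x a b, Ladder D x a b ∧ C = insert (x + 1, b) D ∧ IsTreeCompl ν (insert (x, a) D) := by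
  obtain ⟨x, b, h1, h2, h3⟩ := exists_lowest_gap hC
  obtain ⟨-, h5, h6⟩ := isNuTree_iff.1 h.2
  have hins := Finset.insert_erase h2
  have hqA := h.1 h2
  have hq := mem_A.1 hqA
  have hul : (x, b) ∈ A ν \ C := Finset.mem_sdiff.2 ⟨mem_A.2 ⟨hq.1, by omega⟩, h1⟩
  have hex : ∃ c, c < b ∧ (x, c) ∉ C ∧ x + 1 ≤ rowEnd ν c := by
    obtain ⟨⟨c, d⟩, ht, ⟨e1, e2, e3⟩ | ⟨e1, e2, e3⟩⟩ := h6 _ hqA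
      (fun e => (Finset.mem_sdiff.1 e).2 h2)
    · simp only at e1 e2 e3
      exact absurd ⟨by simp only; omega, e2, e3⟩ (h5 _ hul _ ht)
    · simp only at e1 e2 e3
      rcases Nat.lt_succ_iff_lt_or_eq.1 e1 with hc | rfl
      · exact absurd ⟨hc, e2, by simp only; omega⟩ (h5 _ ht _ hul)
      · exact ⟨d, e2, (Finset.mem_sdiff.1 ht).2, e3⟩
  obtain ⟨a, hab, hna, hR, hbet⟩ : ∃ a < b, (x, a) ∉ C ∧ x + 1 ≤ rowEnd ν a ∧
      ∀ c, a < c → c < b → (x, c) ∈ C := by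
    classical
    let P := fun c => c < b ∧ (x, c) ∉ C ∧ x + 1 ≤ rowEnd ν c
    obtain ⟨c, hc⟩ := hex
    have hspec : P (Nat.findGreatest P b) := Nat.findGreatest_spec (m := c) hc.1.le hc
    refine ⟨Nat.findGreatest P b, hspec.1, hspec.2.1, hspec.2.2, fun d hd hdb => ?_⟩
    by_contra hcon
    exact Nat.findGreatest_is_greatest hd hdb.le
      ⟨hdb, hcon, hspec.2.2.trans (rowEnd_mono ν hd.le)⟩
  have hll : (x, a) ∈ A ν \ C := Finset.mem_sdiff.2 ⟨mem_A.2 ⟨by omega, by omega⟩, hna⟩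
  have hL : Ladder (C.erase (x + 1, b)) x a b := by
    refine ⟨hab, by simp [hna], fun hlr => hna (h3 a hab x (Finset.mem_of_mem_erase hlr)),
      by simp [h1], by simp, fun c hc hcb => ?_⟩
    have hc2 : (x + 1, c) ∈ C := by
      by_contra hcC
      exact h5 _ hll (x + 1, c) (Finset.mem_sdiff.2
        ⟨mem_A.2 ⟨by omega, hR.trans (rowEnd_mono ν hc.le)⟩, hcC⟩) ⟨Nat.lt_succ_self x, hc, hR⟩
    have hc1 := hbet c hc hcb
    simp only [Finset.mem_erase, ne_eq, Prod.mk.injEq, hc1, hc2, and_true]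
    omega
  refine ⟨_, x, a, b, hL, hins.symm, hL.isTreeCompl_lower hR ?_⟩
  rwa [hins]

/-- The crossings of the reduced pipe dreams are the complements of the `ν`-trees. -/
theorem isDream_iff {ν : LatticePath} {C : Finset (ℕ × ℕ)} : IsDream ν C ↔ IsTreeCompl ν C := by
  have key : ∀ N, ∀ C : Finset (ℕ × ℕ), ∑ p ∈ C, p.1 = N → (IsDream ν C ↔ IsTreeCompl ν C) := by
    intro N
    induction N using Nat.strong_induction_on with
    | _ N ih =>
      intro C hN
      by_cases hC : ∀ x y, (x + 1, y) ∈ C → (x, y) ∈ C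
      · constructor
        · intro h
          rw [h.eq_corners hC]
          exact isTreeCompl_corners ν
        · intro h
          rw [h.eq_corners hC]
          exact ⟨corners_subset_rect ν, rfl, rfl⟩
      · constructor
        · intro h
          obtain ⟨D, x, a, b, hL, rfl, h'⟩ := h.exists_ladder hC
          refine hL.isTreeCompl_upper
            (mem_rect.1 (h.subset (Finset.mem_insert_self _ _))).2 ?_
          exact (ih _ (hN ▸ sum_lower_lt hL) _ rfl).1 h'
        · intro h
          obtain ⟨D, x, a, b, hL, rfl, h'⟩ := h.exists_ladder hC
          have h'' := (ih _ (hN ▸ sum_lower_lt hL) _ rfl).2 h'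
          have hsub := h.1.trans (A_subset_rect ν)
          have hq := mem_rect.1 (hsub (Finset.mem_insert_self _ _))
          refine ⟨hsub, ?_, ?_⟩
          · rw [← h''.perm_eq, perm, perm, hL.ev_insert_eq (by omega) hq.2]
          · rw [← h''.card_eq, Finset.card_insert_of_notMem hL.upper_right,
              Finset.card_insert_of_notMem hL.lower_left]
  exact key _ C rfl

/-! ### Permutations of an initial segment as permutations of the natural numbers -/

/-- A permutation of `Fin N`, extended by the identity to the natural numbers. -/
noncomputable def extendNat (N : ℕ) : Equiv.Perm (Fin N) →* Equiv.Perm ℕ :=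
  Equiv.Perm.extendDomainHom Fin.equivSubtype

theorem extendNat_injective (N : ℕ) : Function.Injective (extendNat N) :=
  Equiv.Perm.extendDomainHom_injective _

theorem extendNat_apply {N : ℕ} (π : Equiv.Perm (Fin N)) (i : Fin N) :
    extendNat N π i = π i :=
  Equiv.Perm.extendDomain_apply_image π Fin.equivSubtype i

theorem extendNat_apply_of_le {N i : ℕ} (π : Equiv.Perm (Fin N)) (h : N ≤ i) :
    extendNat N π i = i :=
  Equiv.Perm.extendDomain_apply_not_subtype π Fin.equivSubtype (not_lt_of_ge h)

theorem extendNat_simple {n : ℕ} (d : Fin n) : extendNat (n + 1) (simple d) = sw d := by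
  ext i
  rcases Nat.lt_or_ge i (n + 1) with h | h
  · have := extendNat_apply (simple d) ⟨i, h⟩
    simp only at this
    rw [this, simple, sw, Equiv.swap_apply_def, Equiv.swap_apply_def]
    simp only [Fin.ext_iff, Fin.val_castSucc, Fin.val_succ]
    split_ifs <;> simp
  · rw [extendNat_apply_of_le _ h, sw_apply_of_ne] <;> omega

theorem extendNat_prod {n : ℕ} (w : List (Fin n)) :
    extendNat (n + 1) (w.map simple).prod = ev (w.map Fin.val) := by
  rw [map_list_prod, List.map_map, ev, List.map_map]
  congr 1
  exact List.map_congr_left fun d _ => extendNat_simple d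

theorem rothe_eq_image {N : ℕ} (π : Equiv.Perm (Fin N)) :
    rothe π = (fun b : ℕ × ℕ => (b.1 + 1, b.2 + 1)) '' rotheNat (extendNat N π) := by
  ext b
  constructor
  · rintro ⟨i, j, h1, h2, rfl⟩
    refine ⟨(π j, i), ⟨i, j, h1, ?_, ?_⟩, rfl⟩
    · rw [extendNat_apply, extendNat_apply]
      exact h2
    · rw [extendNat_apply]
  · rintro ⟨_, ⟨i, j, h1, h2, rfl⟩, rfl⟩
    have hj : j < N := by
      by_contra! hj
      rw [extendNat_apply_of_le _ hj] at h2
      rcases Nat.lt_or_ge i N with hi | hi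
      · have := extendNat_apply π ⟨i, hi⟩
        simp only at this
        omega
      · rw [extendNat_apply_of_le _ hi] at h2
        omega
    have ei := extendNat_apply π ⟨i, h1.trans hj⟩
    have ej := extendNat_apply π ⟨j, hj⟩
    simp only at ei ej
    refine ⟨⟨i, h1.trans hj⟩, ⟨j, hj⟩, h1, ?_, ?_⟩
    · rw [Fin.lt_def, ← ei, ← ej]
      exact h2
    · simp [ej]

/-- A permutation is determined by its Rothe diagram: at the first position at which two
permutations differ, the one with the larger value has an additional cell. -/
theorem rothe_injective {N : ℕ} : Function.Injective (rothe (n := N)) := by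
  have key : ∀ π π' : Equiv.Perm (Fin N), rothe π = rothe π' → ∀ i, (∀ j < i, π j = π' j) →
      ¬ π i < π' i := by
    intro π π' h i hi hlt
    obtain ⟨j, hj⟩ := π'.surjective (π i)
    have hij : i < j := by
      rcases lt_trichotomy i j with h1 | rfl | h1
      · exact h1
      · exact absurd hj hlt.ne'
      · rw [← hi j h1] at hj
        exact absurd (π.injective hj) h1.ne
    have hmem : ((π i : ℕ) + 1, (i : ℕ) + 1) ∈ rothe π' := ⟨i, j, hij, hj ▸ hlt, by rw [hj]⟩
    rw [← h] at hmem
    obtain ⟨a, b, -, h2, h3⟩ := hmem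
    simp only [Prod.mk.injEq, Nat.add_right_cancel_iff] at h3
    have h4 : π i = π b := Fin.ext h3.1
    have h5 : i = a := Fin.ext h3.2
    rw [← h5, ← h4] at h2
    exact lt_irrefl _ h2
  intro π π' h
  ext1 i
  induction i using WellFoundedLT.induction with
  | _ i ih =>
    rcases lt_trichotomy (π i) (π' i) with h1 | h1 | h1
    · exact absurd h1 (key π π' h i ih)
    · exact h1
    · exact absurd h1 (key π' π h.symm i fun j hj => (ih j hj).symm)

/-! ### The word of a lattice path -/

theorem pairwise_reading (ν : LatticePath) :
    (reading ν).Pairwise fun p q => p.2 < q.2 ∨ p.2 = q.2 ∧ p.1 < q.1 := by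
  rw [reading, List.pairwise_flatMap]
  constructor
  · intro y _
    rw [List.pairwise_map]
    exact (List.pairwise_lt_range.filter _).imp fun h => Or.inr ⟨rfl, h⟩
  · refine List.pairwise_lt_range.imp fun {a b} hab p hp q hq => Or.inl ?_
    rw [List.mem_map] at hp hq
    obtain ⟨x, -, rfl⟩ := hp
    obtain ⟨x', -, rfl⟩ := hq
    exact hab

theorem nodup_reading (ν : LatticePath) : (reading ν).Nodup :=
  (pairwise_reading ν).imp fun h e => by subst e; omega

theorem point_injective (ν : LatticePath) : Function.Injective (point ν) :=
  (nodup_reading ν).injective_get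

theorem point_mem (ν : LatticePath) (k : Fin (reading ν).length) : point ν k ∈ A ν :=
  mem_reading.1 (List.get_mem _ k)

theorem exists_point {ν : LatticePath} {p : ℕ × ℕ} (hp : p ∈ A ν) : ∃ k, point ν k = p :=
  List.mem_iff_get.1 (mem_reading.2 hp)

theorem point_snd_mono (ν : LatticePath) {k l : Fin (reading ν).length} (h : k < l) :
    (point ν k).2 ≤ (point ν l).2 := by
  have := List.pairwise_iff_get.1 (pairwise_reading ν) k l h
  simp only [point]
  omega

theorem lt_of_point_snd_lt {ν : LatticePath} {k l : Fin (reading ν).length}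
    (h : (point ν k).2 < (point ν l).2) : k < l := by
  by_contra! hlk
  rcases hlk.eq_or_lt with rfl | hlk
  · exact lt_irrefl _ h
  · exact absurd (point_snd_mono ν hlk) (not_le_of_gt h)

/-- The points of `A ν` at the positions outside of `I`. -/
def compl (ν : LatticePath) (I : Finset (Fin (reading ν).length)) : Finset (ℕ × ℕ) :=
  A ν \ I.image (point ν)

/-- The positions of the points of `T`. -/
def positionsOf (ν : LatticePath) (T : Finset (ℕ × ℕ)) : Finset (Fin (reading ν).length) :=
  Finset.univ.filter fun k => point ν k ∈ T

theorem image_positionsOf {ν : LatticePath} {T : Finset (ℕ × ℕ)} (hT : T ⊆ A ν) :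
    (positionsOf ν T).image (point ν) = T := by
  ext p
  simp only [positionsOf, Finset.mem_image, Finset.mem_filter, Finset.mem_univ, true_and]
  constructor
  · rintro ⟨k, hk, rfl⟩
    exact hk
  · intro hp
    obtain ⟨k, rfl⟩ := exists_point (hT hp)
    exact ⟨k, hp, rfl⟩

theorem map_val_complementSubword (ν : LatticePath) (I : Finset (Fin (reading ν).length)) :
    (complementSubword (Qword ν) I).map Fin.val =
      letters (height ν) (width ν) (compl ν I) (height ν + 1) := by
  have h1 : (complementSubword (Qword ν) I).map Fin.val =
      ((reading ν).filter fun p => p ∈ compl ν I).map (dist ν) := by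
    have e : ((reading ν).filter fun p => p ∈ compl ν I) =
        ((List.finRange _).filter fun k => k ∉ I).map (point ν) := by
      conv_lhs => rw [← List.map_get_finRange (reading ν)]
      rw [List.filter_map]
      refine congrArg _ (List.filter_congr fun k _ => ?_)
      have : point ν k ∈ compl ν I ↔ k ∉ I := by
        rw [compl, Finset.mem_sdiff, (point_injective ν).mem_finset_image]
        exact and_iff_right (point_mem ν k)
      exact (decide_eq_decide.2 this)
    rw [e, complementSubword, List.map_map, List.map_map]
    rfl
  rw [h1, reading, List.filter_flatMap, List.map_flatMap, letters]
  refine List.flatMap_congr fun y _ => ?_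
  rw [List.filter_map, List.filter_filter, List.map_map, rowLetters]
  have : ((List.range (width ν + 1)).filter fun x =>
      ((fun p => decide (p ∈ compl ν I)) ∘ fun x => (x, y)) x && decide ((x, y) ∈ A ν)) =
      (List.range (width ν + 1)).filter fun x => (x, y) ∈ compl ν I := by
    refine List.filter_congr fun x _ => ?_
    have : (x, y) ∈ compl ν I → (x, y) ∈ A ν := fun h => (Finset.mem_sdiff.1 h).1
    by_cases h : (x, y) ∈ compl ν I
    · simp [h, this h]
    · simp [h]
  rw [this]
  rfl

theorem length_complementSubword (ν : LatticePath) (I : Finset (Fin (reading ν).length)) :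
    (complementSubword (Qword ν) I).length = (compl ν I).card := by
  have hsub : compl ν I ⊆ rect ν := Finset.sdiff_subset.trans (A_subset_rect ν)
  rw [← length_letters_of_subset hsub, ← map_val_complementSubword, List.length_map]

theorem extendNat_complementSubword (ν : LatticePath) (I : Finset (Fin (reading ν).length)) :
    extendNat _ ((complementSubword (Qword ν) I).map simple).prod = perm ν (compl ν I) := by
  rw [extendNat_prod, map_val_complementSubword, perm]

theorem compl_positionsOf_corners (ν : LatticePath) :
    compl ν (positionsOf ν (A ν \ corners ν)) = corners ν := by
  rw [compl, image_positionsOf Finset.sdiff_subset, Finset.sdiff_sdiff_eq_self]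
  exact Finset.filter_subset _ _

/-- The permutation of `ν`, as the product of the letters at the lower left corners of the
cells. -/
def nuPerm (ν : LatticePath) : Equiv.Perm (Fin (maxDist ν + 1 + 1)) :=
  ((complementSubword (Qword ν) (positionsOf ν (A ν \ corners ν))).map simple).prod

theorem extendNat_nuPerm (ν : LatticePath) : extendNat _ (nuPerm ν) = perm ν (corners ν) := by
  rw [nuPerm, extendNat_complementSubword, compl_positionsOf_corners]

theorem isNuPerm_nuPerm (ν : LatticePath) : IsNuPerm ν (nuPerm ν) := by
  rw [IsNuPerm, rothe_eq_image, extendNat_nuPerm]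
  congr 1
  ext ⟨v, i⟩
  rw [mem_rotheNat_perm_corners]
  simp only [ferrers, Set.mem_ofPred_eq, mem_A]
  constructor
  · rintro ⟨y, hy, rfl, h1, h2⟩
    have := rowEnd_le_width ν y
    rw [show height ν - (height ν - y) = y by omega]
    omega
  · rintro ⟨h1, h2, h3, h4, h5, h6⟩
    exact ⟨height ν - v, by omega, by omega, by omega, by omega⟩

theorem isNuPerm_iff {ν : LatticePath} {π : Equiv.Perm (Fin (maxDist ν + 1 + 1))} :
    IsNuPerm ν π ↔ π = nuPerm ν := by
  constructor
  · intro h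
    exact rothe_injective (h.trans (isNuPerm_nuPerm ν).symm)
  · rintro rfl
    exact isNuPerm_nuPerm ν

theorem isReducedExpression_iff_isDream {ν : LatticePath} {I : Finset (Fin (reading ν).length)} :
    IsReducedExpression (complementSubword (Qword ν) I) (nuPerm ν) ↔ IsDream ν (compl ν I) := by
  have hsub : compl ν I ⊆ rect ν := Finset.sdiff_subset.trans (A_subset_rect ν)
  have hprod : ∀ w : List (Fin (maxDist ν + 1)), (w.map simple).prod = nuPerm ν →
      (corners ν).card ≤ w.length := by
    intro w hw
    have := card_corners_le (ν := ν) (l := w.map Fin.val)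
      (by rw [← extendNat_nuPerm, ← hw, extendNat_prod])
    rwa [List.length_map] at this
  constructor
  · rintro ⟨h1, h2⟩
    refine ⟨hsub, by rw [← extendNat_complementSubword, h1, extendNat_nuPerm], ?_⟩
    have h3 := hprod _ h1
    have h4 := h2 (complementSubword (Qword ν) (positionsOf ν (A ν \ corners ν))) rfl
    rw [length_complementSubword] at h3
    rw [length_complementSubword, length_complementSubword, compl_positionsOf_corners] at h4
    omega
  · rintro ⟨-, h1, h2⟩
    refine ⟨extendNat_injective _ ?_, fun w hw => ?_⟩
    · rw [extendNat_complementSubword, h1, extendNat_nuPerm]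
    · rw [length_complementSubword, h2]
      exact hprod w hw

/-- The facets of the subword complex are the `ν`-trees. -/
theorem isFacet_iff_isNuTree {ν : LatticePath} {I : Finset (Fin (reading ν).length)} :
    IsFacet (Qword ν) (nuPerm ν) I ↔ IsNuTree ν (I.image (point ν)) := by
  rw [isFacet_iff, isReducedExpression_iff_isDream, isDream_iff, IsTreeCompl, compl]
  have hI : I.image (point ν) ⊆ A ν := by
    intro p hp
    obtain ⟨k, -, rfl⟩ := Finset.mem_image.1 hp
    exact point_mem ν k
  rw [Finset.sdiff_sdiff_eq_self hI]
  exact and_iff_right Finset.sdiff_subset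

theorem bijOn_facets (ν : LatticePath) :
    Set.BijOn (fun I : Finset (Fin (reading ν).length) => I.image (point ν))
      {I | IsFacet (Qword ν) (nuPerm ν) I} {T | IsNuTree ν T} := by
  refine ⟨fun I hI => isFacet_iff_isNuTree.1 hI,
    (Finset.image_injective (point_injective ν)).injOn, fun T hT => ?_⟩
  have hTA : T ⊆ A ν := (isNuTree_iff.1 hT).1
  refine ⟨positionsOf ν T, ?_, image_positionsOf hTA⟩
  rw [Set.mem_ofPred_eq, isFacet_iff_isNuTree, image_positionsOf hTA]
  exact hT

/-! ### The increasing flip poset -/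

/-- The `ν`-tree of a facet. -/
def Facet.tree {ν : LatticePath} (I : Facet (Qword ν) (nuPerm ν)) : Finset (ℕ × ℕ) :=
  I.positions.image (point ν)

theorem Facet.flush {ν : LatticePath} (I : Facet (Qword ν) (nuPerm ν)) : Flush ν I.tree :=
  (isFacet_iff_isNuTree.1 I.isFacet).flush

theorem Facet.tree_injective {ν : LatticePath} :
    Function.Injective (Facet.tree (ν := ν)) := by
  rintro ⟨I, hI⟩ ⟨J, hJ⟩ h
  have : I = J := Finset.image_injective (point_injective ν) h
  subst this
  rfl

theorem card_row (T : Finset (ℕ × ℕ)) (y : ℕ) :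
    (row T y).card = (T.filter fun p => p.2 = y).card := by
  refine Finset.card_image_of_injOn ?_
  rintro ⟨a, b⟩ h1 ⟨c, d⟩ h2 h3
  have h1 := (Finset.mem_filter.1 (Finset.mem_coe.1 h1)).2
  have h2 := (Finset.mem_filter.1 (Finset.mem_coe.1 h2)).2
  simp only at h1 h2 h3
  rw [h1, h2, h3]

/-- The increasing flips are the flips of `ν`-trees: a flip cannot exchange two points of the
same row, as a `ν`-tree is determined by the sizes of its rows. -/
theorem increasingFlip_iff {ν : LatticePath} {I J : Facet (Qword ν) (nuPerm ν)} :
    IncreasingFlip I J ↔ ∃ i j, FlipAt I.tree J.tree i j := by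
  have himage : ∀ (K : Facet (Qword ν) (nuPerm ν)) k,
      (K.positions.erase k).image (point ν) = K.tree.erase (point ν k) :=
    fun K k => Finset.image_erase (point_injective ν) _ _
  have hmem : ∀ (K : Facet (Qword ν) (nuPerm ν)) k, point ν k ∈ K.tree ↔ k ∈ K.positions :=
    fun K k => (point_injective ν).mem_finset_image
  constructor
  · rintro ⟨k, hk, l, hl, hkl, he⟩
    have he' : I.tree.erase (point ν k) = J.tree.erase (point ν l) := by
      rw [← himage, ← himage, he]
    refine ⟨point ν k, point ν l, (hmem I k).2 hk, (hmem J l).2 hl,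
      lt_of_le_of_ne (point_snd_mono ν hkl) fun hrow => ?_, he'⟩
    have hcard : ∀ y, (row I.tree y).card = (row J.tree y).card := by
      intro y
      rw [card_row, card_row, ← Finset.insert_erase ((hmem I k).2 hk),
        ← Finset.insert_erase ((hmem J l).2 hl), ← he', Finset.filter_insert, Finset.filter_insert,
        hrow]
      split_ifs
      · rw [Finset.card_insert_of_notMem (by simp), Finset.card_insert_of_notMem (by
          rw [he']; simp)]
      · rfl
    have hIJ : I.tree = J.tree :=
      I.flush.eq_of_card_row J.flush.toFlushBelow fun y _ => hcard y
    obtain rfl := Facet.tree_injective hIJ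
    have : l ∈ I.positions.erase k := Finset.mem_erase.2 ⟨hkl.ne', hl⟩
    rw [he] at this
    exact Finset.notMem_erase _ _ this
  · rintro ⟨i, j, h1, h2, h3, h4⟩
    obtain ⟨k, hk, rfl⟩ := Finset.mem_image.1 h1
    obtain ⟨l, hl, rfl⟩ := Finset.mem_image.1 h2
    refine ⟨k, hk, l, hl, lt_of_point_snd_lt h3, ?_⟩
    rw [← himage, ← himage] at h4
    exact Finset.image_injective (point_injective ν) h4

theorem exists_equiv_facet (ν : LatticePath) :
    ∃ e : NuPath ν ≃ Facet (Qword ν) (nuPerm ν),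
      ∀ μ μ', TamariCover μ μ' ↔ IncreasingFlip (e μ) (e μ') := by
  have hex : ∀ μ : NuPath ν, ∃ I : Facet (Qword ν) (nuPerm ν),
      ∀ y ≤ height ν, dead I.tree (y + 1) = rowEnd μ.word y := by
    intro μ
    obtain ⟨T, hT, hd⟩ := μ.exists_flush
    have hpos := image_positionsOf hT.subset
    refine ⟨⟨positionsOf ν T, ?_⟩, ?_⟩
    · rw [isFacet_iff_isNuTree, hpos]
      exact hT.isNuTree
    · rw [Facet.tree, hpos]
      exact hd
  choose f hf using hex
  have hbij : Function.Bijective f := by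
    constructor
    · intro μ μ' h
      refine NuPath.ext_rowEnd fun y hy => ?_
      rw [← hf μ y hy, ← hf μ' y hy, h]
    · intro I
      obtain ⟨μ, hμ⟩ := I.flush.exists_nuPath
      refine ⟨μ, Facet.tree_injective ((f μ).flush.eq_of_dead I.flush fun y hy => ?_)⟩
      rw [hf μ y hy, hμ y hy]
  refine ⟨Equiv.ofBijective f hbij, fun μ μ' => ?_⟩
  rw [increasingFlip_iff]
  exact tamariCover_iff_flipAt (f μ).flush (f μ').flush (hf μ) (hf μ')

/-- The `ν`-Tamari poset is the increasing flip poset, by an isomorphism that respects the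
generating relations of the two orders. -/
theorem exists_orderIso_facet (ν : LatticePath) :
    ∃ e : NuPath ν ≃o Facet (Qword ν) (nuPerm ν),
      ∀ μ μ', TamariCover μ μ' ↔ IncreasingFlip (e μ) (e μ') := by
  obtain ⟨e, he⟩ := exists_equiv_facet ν
  refine ⟨⟨e, fun {μ μ'} => ⟨fun h => ?_, fun h => ?_⟩⟩, he⟩
  · have h' : Relation.ReflTransGen IncreasingFlip (e μ) (e μ') := h
    have hlift : Relation.ReflTransGen TamariCover (e.symm (e μ)) (e.symm (e μ')) :=
      h'.lift e.symm fun I J hIJ => (he _ _).2 (by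
        rwa [Equiv.apply_symm_apply, Equiv.apply_symm_apply])
    rwa [Equiv.symm_apply_apply, Equiv.symm_apply_apply] at hlift
  · have h' : Relation.ReflTransGen TamariCover μ μ' := h
    exact h'.lift (p := IncreasingFlip) e fun _ _ h => (he _ _).1 h

end NuTamari

theorem theorem5p3 (ν : NuTamari.LatticePath) :
    (∃! π, NuTamari.IsNuPerm ν π) ∧
    ∀ π, NuTamari.IsNuPerm ν π →
      Set.BijOn (fun I : Finset (Fin (NuTamari.reading ν).length) => I.image (NuTamari.point ν))
        {I | NuTamari.IsFacet (NuTamari.Qword ν) π I} {T | NuTamari.IsNuTree ν T} ∧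
      Nonempty (NuTamari.NuPath ν ≃o NuTamari.Facet (NuTamari.Qword ν) π) ∧
      (∀ μ μ' : NuTamari.NuPath ν, μ ⋖ μ' ↔ NuTamari.TamariCover μ μ') ∧
      (∀ I J : NuTamari.Facet (NuTamari.Qword ν) π, I ⋖ J ↔ NuTamari.IncreasingFlip I J) := by
  refine ⟨⟨NuTamari.nuPerm ν, NuTamari.isNuPerm_nuPerm ν,
    fun π hπ => NuTamari.isNuPerm_iff.1 hπ⟩, fun π hπ => ?_⟩
  obtain rfl := NuTamari.isNuPerm_iff.1 hπ
  obtain ⟨e, he⟩ := NuTamari.exists_orderIso_facet ν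
  refine ⟨NuTamari.bijOn_facets ν, ⟨e⟩, fun μ μ' => NuTamari.covBy_iff_tamariCover, fun I J => ?_⟩
  have := he (e.symm I) (e.symm J)
  rw [OrderIso.apply_symm_apply, OrderIso.apply_symm_apply,
    ← NuTamari.covBy_iff_tamariCover] at this
  rw [← this, apply_covBy_apply_iff]
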